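/- Let $M$ be a smooth, connected, finite-dimensional Riemannian manifold, possibly with boundary, which is complete for its Riemannian distance $d$. Let $1\le r\le\infty$, let $h\colon M\to\mathbb R$ be a $C^r$ function with $0$ as a regular value and with $\Sigma=h^{-1}(0)$ compact, put $M_\pm=\{\pm h>0\}$, and let $Z_+,Z_-$ be $C^r$ vector fields on $M$. Write $Xh=dh(X)$. The associated Filippov field is the multivalued field $Z=\frac{Z_++Z_-}{2}+\operatorname{sgn}(h)\frac{Z_+-Z_-}{2}$, where $\operatorname{sgn}(0)=[-1,1]$; so $Z=Z_\pm$ on $M_\pm$ and $Z(p)$ is the segment joining $Z_+(p)$ and $Z_-(p)$ for $p\in\Sigma$. A point $p\in\Sigma$ is a tangency point if $Z_+h(p)\,Z_-h(p)=0$ and a sliding point if $Z_+h(p)\,Z_-h(p)<0$; at sliding points the sliding field is $Z_s=\frac{Z_-h\,Z_+-Z_+h\,Z_-}{Z_-h-Z_+h}$. A Filippov trajectory on an interval $J\subseteq\mathbb R$ is a continuous curve $\gamma\colon J\to M$ such that: (i) for every $t\in J$ with $\gamma(t)$ not a tangency point, there are, unless $t$ is the right (respectively left) endpoint of $J$, an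 interval $(t,b)$ (respectively $(a,t)$) in $J$ on which $\gamma$ is an integral curve of $Z_+$ inside $M_+$, or of $Z_-$ inside $M_-$, or of $Z_s$ inside the set of sliding points (thus $\gamma$ is piecewise smooth, and its pieces can accumulate only at tangency points); (ii) $\gamma$ is constantly equal to a tangency point $p$ on an interval of positive length only if $0\in Z(p)$. An orbit is a curve $\gamma\colon\mathbb R\to M$ that is a Filippov trajectory on a non-empty closed interval $J$ such that, for each finite endpoint $\omega$ of $J$, $\gamma(\omega)\in\partial M$ and $\gamma$ is constantly equal to $\gamma(\omega)$ beyond $\omega$ (the trajectory stops at the boundary and is extended by a constant; $J$ may be a single point, and $J=\mathbb R$ if $\partial M=\emptyset$). The orbit space $\widetilde M$ is the set of all orbits, and the integral distance is $$\tilde d(\gamma_0,\gamma_1)=\sum_{i\in\mathbb Z}\frac1{2^{|i|}}\int_i^{i+1}d(\gamma_0(t),\gamma_1(t))\,dt .$$ Suppose that $Z$ is bounded, i.e. $\sup\{\|v\|: p\in M,\ v\in Z(p)\}<\infty$, and that the set of tangency points is finite. Then the series defining $\tilde d$ always converges, $\tilde d$ is a metric on $\widetilde M$, and $(\widetilde M,\tilde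 d)$ is complete. Moreover, every Cauchy sequence $(\gamma_n)$ in $\widetilde M$ converges pointwise on $\mathbb R$, its pointwise limit $\gamma$ is an orbit, and $\tilde d(\gamma_n,\gamma)\to0$. If in addition every $\gamma_n$ is a Filippov trajectory on all of $\mathbb R$, then so is $\gamma$. -/

import Mathlib

open Set Filter Topology Manifold
open scoped ContDiff Bundle

noncomputable section

/-- A nonsmooth vector field of class `C^r` on `M`: the vector field `Zp` governs the region `h > 0`
and `Zm` governs the region `h < 0`; the switching manifold `h = 0` is compact and `0` is a regular
value of `h`. -/
structure FilippovSystem {E : Type*} [NormedAddCommGroup E] [NormedSpace ℝ E]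
    {H : Type*} [TopologicalSpace H] (I : ModelWithCorners ℝ E H)
    (M : Type*) [TopologicalSpace M] [ChartedSpace H M] [IsManifold I ∞ M] (r : ℕ∞) where
  h : M → ℝ
  Zp : (p : M) → TangentSpace I p
  Zm : (p : M) → TangentSpace I p
  contMDiff_h : ContMDiff I 𝓘(ℝ, ℝ) r h
  contMDiff_Zp : ContMDiff I I.tangent r (fun p => (⟨p, Zp p⟩ : TangentBundle I M))
  contMDiff_Zm : ContMDiff I I.tangent r (fun p => (⟨p, Zm p⟩ : TangentBundle I M))
  regular : ∀ p, h p = 0 → mfderiv I 𝓘(ℝ, ℝ) h p ≠ 0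
  compact_switch : IsCompact {p | h p = 0}

namespace FilippovSystem

variable {E : Type*} [NormedAddCommGroup E] [NormedSpace ℝ E]
  {H : Type*} [TopologicalSpace H] {I : ModelWithCorners ℝ E H}
  {M : Type*} [TopologicalSpace M] [ChartedSpace H M] [IsManifold I ∞ M] {r : ℕ∞}

/-- The switching manifold. -/
def switch (S : FilippovSystem I M r) : Set M := {p | S.h p = 0}

/-- The region `M₊`. -/
def regionPos (S : FilippovSystem I M r) : Set M := {p | 0 < S.h p}

/-- The region `M₋`. -/
def regionNeg (S : FilippovSystem I M r) : Set M := {p | S.h p < 0}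

/-- The Lie derivative `Xh(p) = dh_p (X p) = ⟨∇h(p), X(p)⟩`. -/
def lie (S : FilippovSystem I M r) (X : (p : M) → TangentSpace I p) (p : M) : ℝ :=
  mfderiv I 𝓘(ℝ, ℝ) S.h p (X p)

/-- Tangency points. -/
def tangency (S : FilippovSystem I M r) : Set M :=
  {p | p ∈ S.switch ∧ S.lie S.Zp p * S.lie S.Zm p = 0}

/-- Sliding points (stable and unstable). -/
def sliding (S : FilippovSystem I M r) : Set M :=
  {p | p ∈ S.switch ∧ S.lie S.Zp p * S.lie S.Zm p < 0}

/-- The sliding vector field `Z_s`; it is meaningful at sliding points only. -/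
def Zs (S : FilippovSystem I M r) (p : M) : TangentSpace I p :=
  (1 / (S.lie S.Zm p - S.lie S.Zp p)) • (S.lie S.Zm p • S.Zp p - S.lie S.Zp p • S.Zm p)

/-- The sign function, with values `[-1, 1]` at the origin. -/
def sgnValues (x : ℝ) : Set ℝ :=
  {s | (0 < x → s = 1) ∧ (x < 0 → s = -1) ∧ (x = 0 → s ∈ Icc (-1 : ℝ) 1)}

/-- The set of values at `p` of the multivalued field
`Z = (Z₊ + Z₋) / 2 + sgn(h) (Z₊ - Z₋) / 2`. -/
def values (S : FilippovSystem I M r) (p : M) : Set (TangentSpace I p) :=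
  {v | ∃ s ∈ sgnValues (S.h p),
    v = (1 / 2 : ℝ) • (S.Zp p + S.Zm p) + (s / 2) • (S.Zp p - S.Zm p)}

/-- On the open interval `(a, b)`, the curve `γ` is a single smooth piece: an integral curve of `Z₊`
in `M₊`, of `Z₋` in `M₋`, or of `Z_s` in the sliding region. -/
def IsPiece (S : FilippovSystem I M r) (γ : ℝ → M) (a b : ℝ) : Prop :=
  (MapsTo γ (Ioo a b) S.regionPos ∧ IsMIntegralCurveOn γ S.Zp (Ioo a b)) ∨
  (MapsTo γ (Ioo a b) S.regionNeg ∧ IsMIntegralCurveOn γ S.Zm (Ioo a b)) ∨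
  (MapsTo γ (Ioo a b) S.sliding ∧ IsMIntegralCurveOn γ S.Zs (Ioo a b))

/-- `γ` is a Filippov trajectory on the interval `J`: it is continuous; immediately after and
immediately before each time at which it is not at a tangency point it is a smooth piece (so pieces
can accumulate at tangency points only); and it rests at a tangency point `p` only where
the multivalued field allows it, `0 ∈ Z(p)`. -/
structure IsTrajectoryOn (S : FilippovSystem I M r) (γ : ℝ → M) (J : Set ℝ) : Prop where
  continuousOn : ContinuousOn γ J
  piece_right : ∀ t ∈ J, γ t ∉ S.tangency → ¬ IsGreatest J t →
    ∃ b, t < b ∧ Icc t b ⊆ J ∧ S.IsPiece γ t b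
  piece_left : ∀ t ∈ J, γ t ∉ S.tangency → ¬ IsLeast J t →
    ∃ a, a < t ∧ Icc a t ⊆ J ∧ S.IsPiece γ a t
  rest : ∀ p ∈ S.tangency, ∀ a b, a < b → Icc a b ⊆ J → (∀ t ∈ Icc a b, γ t = p) →
    (0 : TangentSpace I p) ∈ S.values p

/-- `γ : ℝ → M` is an orbit: on a nonempty closed interval `J` it is a Filippov trajectory, each
finite endpoint of `J` is a time at which it stops on the boundary of `M`, and beyond such an
endpoint it is extended by a constant. If `M` has no boundary, then `J = ℝ`. -/
def IsOrbit (S : FilippovSystem I M r) (γ : ℝ → M) : Prop :=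
  ∃ J : Set ℝ, J.Nonempty ∧ IsClosed J ∧ J.OrdConnected ∧ S.IsTrajectoryOn γ J ∧
    (∀ t, IsGreatest J t → γ t ∈ I.boundary M ∧ ∀ s, t ≤ s → γ s = γ t) ∧
    (∀ t, IsLeast J t → γ t ∈ I.boundary M ∧ ∀ s, s ≤ t → γ s = γ t)

/-- The orbit space. -/
def OrbitSpace (S : FilippovSystem I M r) : Type _ := {γ : ℝ → M // S.IsOrbit γ}

end FilippovSystem

namespace FilippovSystem

variable {E : Type*} [NormedAddCommGroup E] [NormedSpace ℝ E]
  {H : Type*} [TopologicalSpace H] {I : ModelWithCorners ℝ E H}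
  {M : Type*} [MetricSpace M] [ChartedSpace H M] [IsManifold I ∞ M] {r : ℕ∞}

/-- The values of the multivalued field `Z` are bounded in the Riemannian norm. -/
def Bounded [Bundle.RiemannianBundle (fun p : M => TangentSpace I p)]
    (S : FilippovSystem I M r) : Prop :=
  ∃ C : ℝ, ∀ p, ∀ v ∈ S.values p, ‖v‖ ≤ C

/-- The `i`-th term of the series that defines the integral distance. -/
def distTerm (S : FilippovSystem I M r) (γ₀ γ₁ : S.OrbitSpace) (i : ℤ) : ℝ :=
  1 / 2 ^ i.natAbs * ∫ t in (i : ℝ)..(i + 1), dist (γ₀.1 t) (γ₁.1 t)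

/-- The integral distance on the orbit space. -/
def intDist (S : FilippovSystem I M r) (γ₀ γ₁ : S.OrbitSpace) : ℝ :=
  ∑' i : ℤ, S.distTerm γ₀ γ₁ i

end FilippovSystem

end

noncomputable section

namespace FilippovSystem

section RealAnalysis

/-- A continuous function that passes from below `y` to above `y` has a last time at level `y`. -/
lemma exists_last_eq {g : ℝ → ℝ} {a b y : ℝ} (hab : a ≤ b) (hg : ContinuousOn g (Icc a b))
    (ha : g a < y) (hb : y < g b) :
    ∃ s ∈ Ico a b, g s = y ∧ ∀ x ∈ Ioc s b, y < g x := by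
  have hK : IsCompact (Icc a b ∩ g ⁻¹' Iic y) :=
    isCompact_Icc.of_isClosed_subset (hg.preimage_isClosed_of_isClosed isClosed_Icc isClosed_Iic)
      inter_subset_left
  obtain ⟨s, ⟨hs, hsy⟩, hmax⟩ := hK.exists_isGreatest ⟨a, ⟨le_rfl, hab⟩, ha.le⟩
  have hsb : s < b := lt_of_le_of_ne hs.2 (by rintro rfl; exact absurd hb (not_lt.2 hsy))
  have hlast : ∀ x ∈ Ioc s b, y < g x := fun x hx => by
    by_contra hxy
    exact absurd (hmax ⟨⟨hs.1.trans hx.1.le, hx.2⟩, not_lt.1 hxy⟩) (not_le.2 hx.1)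
  refine ⟨s, ⟨hs.1, hsb⟩, ?_, hlast⟩
  by_contra hne
  obtain ⟨x, hx, hxy⟩ := intermediate_value_Icc hsb.le (hg.mono (Icc_subset_Icc_left hs.1))
    (⟨hsy, hb.le⟩ : y ∈ Icc (g s) (g b))
  rcases hx.1.eq_or_lt with rfl | hlt
  · exact hne hxy
  · exact (hlast x ⟨hlt, hx.2⟩).ne' hxy

/-- A continuous function that decreases immediately after every time decreases. -/
lemma image_le_of_forall_right {f : ℝ → ℝ} {a b : ℝ} (hab : a ≤ b) (hf : ContinuousOn f (Icc a b))
    (h : ∀ s ∈ Ico a b, ∃ s' > s, ∀ x ∈ Ioo s s', f x ≤ f s) : f b ≤ f a := by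
  by_contra! hlt
  obtain ⟨y, hay, hyb⟩ := exists_between hlt
  obtain ⟨s, hs, hsy, hlast⟩ := exists_last_eq hab hf hay hyb
  obtain ⟨s', hs', hle⟩ := h s hs
  obtain ⟨x, hx, hx'⟩ := exists_between (lt_min hs' hs.2)
  have h1 := hle x ⟨hx, hx'.trans_le (min_le_left _ _)⟩
  have h2 := hlast x ⟨hx, (hx'.trans_le (min_le_right _ _)).le⟩
  linarith

/-- A continuous function grows at rate at most `C` if it does so immediately after every time
outside a set on which it takes finitely many values. -/
lemma image_le_of_forall_right_of_finite {f : ℝ → ℝ} {a b C : ℝ} {T : Set ℝ} (hab : a ≤ b)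
    (hC : 0 ≤ C) (hf : ContinuousOn f (Icc a b)) (hT : (f '' T).Finite)
    (h : ∀ s ∈ Ico a b, s ∉ T → ∃ s' > s, ∀ x ∈ Ioo s s', f x ≤ f s + C * (x - s)) :
    f b ≤ f a + C * (b - a) := by
  by_contra! hlt
  set g : ℝ → ℝ := fun s => f s - C * s with hg
  have hgc : ContinuousOn g (Icc a b) := hf.sub (by fun_prop)
  have hgab : g a < g b := by simp only [hg]; linarith
  have key : ∀ y : Ioo (g a) (g b), ∃ s ∈ Ico a b, g s = y ∧ ∀ x ∈ Ioc s b, (y : ℝ) < g x :=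
    fun y => exists_last_eq hab hgc y.2.1 y.2.2
  choose σ hσ hσy hlast using key
  have hσT : ∀ y, σ y ∈ T := fun y => by
    by_contra hn
    obtain ⟨s', hs', hle⟩ := h _ (hσ y) hn
    obtain ⟨x, hx, hx'⟩ := exists_between (lt_min hs' (hσ y).2)
    have h1 := hle x ⟨hx, hx'.trans_le (min_le_left _ _)⟩
    have h2 := hlast y x ⟨hx, (hx'.trans_le (min_le_right _ _)).le⟩
    rw [← hσy y] at h2
    simp only [hg] at h2
    linarith
  have hmono : StrictMono fun y => f (σ y) := fun y z hyz => by
    have hle : σ y ≤ σ z := by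
      by_contra! hn
      have h1 := hlast z (σ y) ⟨hn, (hσ y).2.le⟩
      rw [hσy y] at h1
      exact absurd h1 (not_lt.2 (Subtype.coe_le_coe.2 hyz.le))
    have h1 := hσy y
    have h2 := hσy z
    have h3 : (y : ℝ) < z := hyz
    have h4 := mul_le_mul_of_nonneg_left hle hC
    simp only [hg] at h1 h2
    simp only
    linarith
  have : Infinite (Ioo (g a) (g b)) := (Ioo_infinite hgab).to_subtype
  exact (infinite_range_of_injective hmono.injective)
    (hT.subset (by rintro _ ⟨y, rfl⟩; exact ⟨_, hσT y, rfl⟩))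

end RealAnalysis

section DerivAlong

variable {E : Type*} [NormedAddCommGroup E] [NormedSpace ℝ E]
  {H : Type*} [TopologicalSpace H] {I : ModelWithCorners ℝ E H}
  {M : Type*} [TopologicalSpace M] [ChartedSpace H M]
  {F : Type*} [NormedAddCommGroup F] [NormedSpace ℝ F]

/-- The derivative at `q` of a function with values in a normed space along a tangent vector. -/
def derivAlong (G : M → F) (q : M) (v : TangentSpace I q) : F :=
  mfderiv I 𝓘(ℝ, F) G q v

lemma derivAlong_add_smul (G : M → F) (q : M) (s t : ℝ) (v w : TangentSpace I q) :
    derivAlong G q (s • v + t • w) = s • derivAlong G q v + t • derivAlong G q w := by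
  unfold derivAlong
  rw [map_add, map_smul, map_smul]
  rfl

lemma _root_.HasMFDerivAt.derivAlong_eq {G : M → F} {q : M} {L : TangentSpace I q →L[ℝ] F}
    (h : HasMFDerivAt I 𝓘(ℝ, F) G q L) (v : TangentSpace I q) : derivAlong G q v = L v := by
  unfold derivAlong
  rw [h.mfderiv]
  rfl

lemma derivAlong_comp_sub {G : M → F} {k : M → ℝ} {q : M} (hG : MDifferentiableAt I 𝓘(ℝ, F) G q)
    (hk : MDifferentiableAt I 𝓘(ℝ, ℝ) k q) (ℓ : F →L[ℝ] ℝ) (D : F) :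
    MDifferentiableAt I 𝓘(ℝ, ℝ) (fun x => ℓ (G x - k x • D)) q ∧
    ∀ v : TangentSpace I q, derivAlong (fun x => ℓ (G x - k x • D)) q v =
      ℓ (derivAlong G q v - derivAlong k q v • D) := by
  have h1 : HasMFDerivAt I 𝓘(ℝ, F) (fun x => k x • D) q
      (((1 : ℝ →L[ℝ] ℝ).smulRight D).comp (mfderiv I 𝓘(ℝ, ℝ) k q : E →L[ℝ] ℝ)) :=
    (((1 : ℝ →L[ℝ] ℝ).smulRight D).hasMFDerivAt (x := k q)).comp q hk.hasMFDerivAt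
  have h2 := hG.hasMFDerivAt.sub h1
  have h := (ℓ.hasMFDerivAt (x := G q - k q • D)).comp q h2
  exact ⟨h.mdifferentiableAt, fun v => h.derivAlong_eq v⟩

lemma derivAlong_const_mul_sq {k : M → ℝ} {q : M} (hk : MDifferentiableAt I 𝓘(ℝ, ℝ) k q) (c : ℝ) :
    MDifferentiableAt I 𝓘(ℝ, ℝ) (fun x => c * k x ^ 2) q ∧
    ∀ v : TangentSpace I q, derivAlong (fun x => c * k x ^ 2) q v = c * (2 * k q * derivAlong k q v) := by
  have hd : HasDerivAt (fun y : ℝ => c * y ^ 2) (c * (2 * k q)) (k q) := by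
    simpa using (hasDerivAt_pow 2 (k q)).const_mul c
  have h := (hasMFDerivAt_iff_hasFDerivAt.2 hd.hasFDerivAt).comp q hk.hasMFDerivAt
  refine ⟨h.mdifferentiableAt, fun v => ?_⟩
  have := h.derivAlong_eq v
  refine this.trans ?_
  change (derivAlong k q v) * (c * (2 * k q)) = _
  ring

lemma derivAlong_const_mul {k : M → ℝ} {q : M} (hk : MDifferentiableAt I 𝓘(ℝ, ℝ) k q) (c : ℝ) :
    MDifferentiableAt I 𝓘(ℝ, ℝ) (fun x => c * k x) q ∧
    ∀ v : TangentSpace I q, derivAlong (fun x => c * k x) q v = c * derivAlong k q v := by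
  have hd : HasDerivAt (fun y : ℝ => c * y) c (k q) := by
    simpa using (hasDerivAt_id (k q)).const_mul c
  have h := (hasMFDerivAt_iff_hasFDerivAt.2 hd.hasFDerivAt).comp q hk.hasMFDerivAt
  refine ⟨h.mdifferentiableAt, fun v => ?_⟩
  refine (h.derivAlong_eq v).trans ?_
  change (derivAlong k q v) * c = _
  ring

lemma hasDerivAt_comp_of_hasMFDerivAt {γ : ℝ → M} {G : M → F} {t : ℝ} {v : TangentSpace I (γ t)}
    (hG : MDifferentiableAt I 𝓘(ℝ, F) G (γ t))
    (hγ : HasMFDerivAt 𝓘(ℝ, ℝ) I γ t ((1 : ℝ →L[ℝ] ℝ).smulRight v)) :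
    HasDerivAt (G ∘ γ) (derivAlong G (γ t) v) t := by
  let L : ℝ →L[ℝ] F := (mfderiv I 𝓘(ℝ, F) G (γ t)).comp ((1 : ℝ →L[ℝ] ℝ).smulRight v)
  have h : HasFDerivAt (G ∘ γ) L t :=
    hasMFDerivAt_iff_hasFDerivAt.1 (HasMFDerivAt.comp t hG.hasMFDerivAt hγ)
  have e : L 1 = derivAlong G (γ t) v := by
    change mfderiv I 𝓘(ℝ, F) G (γ t) ((1 : ℝ) • v) = _
    rw [one_smul]
    rfl
  exact e ▸ h.hasDerivAt

/-- The derivative of a `C¹` function along a continuous vector field is continuous. -/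
lemma continuousOn_derivAlong [IsManifold I 1 M] {N : Set M} (hN : IsOpen N) {G : M → F}
    (hG : ContMDiffOn I 𝓘(ℝ, F) 1 G N) {X : (p : M) → TangentSpace I p}
    (hX : Continuous fun p => (⟨p, X p⟩ : TangentBundle I M)) :
    ContinuousOn (fun q => derivAlong G q (X q)) N := by
  have h := (hG.continuousOn_tangentMapWithin le_rfl hN.uniqueMDiffOn).comp hX.continuousOn
    (fun q hq => (hq : q ∈ N))
  have h2 : ContinuousOn (fun q => (tangentBundleModelSpaceHomeomorph 𝓘(ℝ, F)
      (tangentMapWithin I 𝓘(ℝ, F) G N ⟨q, X q⟩)).2) N :=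
    (continuous_snd.comp (tangentBundleModelSpaceHomeomorph 𝓘(ℝ, F)).continuous).comp_continuousOn h
  refine h2.congr fun q hq => ?_
  change mfderiv I 𝓘(ℝ, F) G q (X q) = mfderivWithin I 𝓘(ℝ, F) G N q (X q)
  rw [mfderivWithin_of_isOpen hN hq]

lemma derivAlong_extChartAt_self [IsManifold I 1 M] (p : M) (v : TangentSpace I p) :
    derivAlong (extChartAt I p) p v = v := by
  refine (HasMFDerivAt.derivAlong_eq (hasMFDerivAt_extChartAt (mem_chart_source H p)) v).trans ?_
  have h := mfderiv_chartAt_eq_tangentCoordChange (I := I) (mem_chart_source H p)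
  exact (congrArg (fun L : E →L[ℝ] E => L v) h).trans
    (tangentCoordChange_self (mem_extChartAt_source p))

end DerivAlong

variable {E : Type*} [NormedAddCommGroup E] [NormedSpace ℝ E]
  {H : Type*} [TopologicalSpace H] {I : ModelWithCorners ℝ E H}
  {M : Type*} [TopologicalSpace M] [ChartedSpace H M] [IsManifold I ∞ M] {r : ℕ∞}

/-- The velocity at `q` of the smooth pieces of trajectories: `Z₊` in `M₊`, `Z₋` in `M₋`, and `Z_s`
at sliding points. -/
def velocities (S : FilippovSystem I M r) (q : M) : Set (TangentSpace I q) :=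
  {v | (0 < S.h q ∧ v = S.Zp q) ∨ (S.h q < 0 ∧ v = S.Zm q) ∨ (q ∈ S.sliding ∧ v = S.Zs q)}

/-- At a sliding point, `Z_s` is a convex combination of `Z₊` and `Z₋`. -/
lemma exists_Zs_eq (S : FilippovSystem I M r) {q : M} (hq : q ∈ S.sliding) :
    ∃ s t : ℝ, 0 ≤ s ∧ 0 ≤ t ∧ s + t = 1 ∧ S.Zs q = s • S.Zp q + t • S.Zm q := by
  have hprod := hq.2
  set x := S.lie S.Zp q with hx
  set y := S.lie S.Zm q with hy
  have hne : y - x ≠ 0 := fun h0 => by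
    have : y = x := by linarith
    rw [this] at hprod
    nlinarith [mul_self_nonneg x]
  refine ⟨y / (y - x), -x / (y - x), ?_, ?_, by field_simp; ring, ?_⟩
  · rcases mul_neg_iff.1 hprod with ⟨h1, h2⟩ | ⟨h1, h2⟩
    · exact div_nonneg_of_nonpos h2.le (by linarith)
    · exact div_nonneg h2.le (by linarith)
  · rcases mul_neg_iff.1 hprod with ⟨h1, h2⟩ | ⟨h1, h2⟩
    · exact div_nonneg_of_nonpos (by linarith) (by linarith)
    · exact div_nonneg (by linarith) (by linarith)
  · rw [Zs, ← hx, ← hy, smul_sub, smul_smul, smul_smul, neg_div, neg_smul, ← sub_eq_add_neg,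
      one_div_mul_eq_div, one_div_mul_eq_div]

lemma IsPiece.exists_hasMFDerivAt {S : FilippovSystem I M r} {γ : ℝ → M} {a b : ℝ}
    (h : S.IsPiece γ a b) {t : ℝ} (ht : t ∈ Ioo a b) :
    ∃ v ∈ S.velocities (γ t), HasMFDerivAt 𝓘(ℝ, ℝ) I γ t ((1 : ℝ →L[ℝ] ℝ).smulRight v) := by
  have hn : Ioo a b ∈ 𝓝 t := Ioo_mem_nhds ht.1 ht.2
  rcases h with ⟨hm, hi⟩ | ⟨hm, hi⟩ | ⟨hm, hi⟩
  · exact ⟨_, Or.inl ⟨hm ht, rfl⟩, (hi t ht).hasMFDerivAt hn⟩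
  · exact ⟨_, Or.inr (Or.inl ⟨hm ht, rfl⟩), (hi t ht).hasMFDerivAt hn⟩
  · exact ⟨_, Or.inr (Or.inr ⟨hm ht, rfl⟩), (hi t ht).hasMFDerivAt hn⟩

/-- The mean value inequality that characterizes the trajectories that avoid the tangency points:
a function whose derivative in all possible directions of motion is at least `c` grows at rate at
least `c`. -/
def SatisfiesMeanValue (S : FilippovSystem I M r) (γ : ℝ → M) (J : Set ℝ) : Prop :=
  ∀ a b, a ≤ b → Icc a b ⊆ J → ∀ N : Set M, IsOpen N → MapsTo γ (Icc a b) N →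
    Disjoint N S.tangency → ∀ G : M → ℝ, (∀ q ∈ N, MDifferentiableAt I 𝓘(ℝ, ℝ) G q) →
    ∀ c : ℝ, (∀ q ∈ N, ∀ v ∈ S.velocities q, c ≤ derivAlong G q v) →
    c * (b - a) ≤ G (γ b) - G (γ a)

lemma not_isGreatest_of_lt {J : Set ℝ} {s t : ℝ} (hst : s < t) (ht : t ∈ J) : ¬ IsGreatest J s :=
  fun h => absurd (h.2 ht) (not_le.2 hst)

lemma IsTrajectoryOn.satisfiesMeanValue {S : FilippovSystem I M r} {γ : ℝ → M} {J : Set ℝ}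
    (h : S.IsTrajectoryOn γ J) : S.SatisfiesMeanValue γ J := by
  intro a b hab hJ N hN hmaps hdisj G hG c hc
  have hγ : ContinuousOn γ (Icc a b) := h.continuousOn.mono hJ
  have hGγ : ContinuousOn (fun s => G (γ s)) (Icc a b) := fun s hs =>
    (hG _ (hmaps hs)).continuousAt.comp_continuousWithinAt (hγ s hs)
  have main : c * b - G (γ b) ≤ c * a - G (γ a) := by
    refine image_le_of_forall_right (f := fun s => c * s - G (γ s)) hab
      ((by fun_prop : Continuous fun s : ℝ => c * s).continuousOn.sub hGγ) fun s hs => ?_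
    have hs' : s ∈ Icc a b := ⟨hs.1, hs.2.le⟩
    obtain ⟨s', hlt, -, hp⟩ := h.piece_right s (hJ hs')
      (fun ht => hdisj.le_bot ⟨hmaps hs', ht⟩) (not_isGreatest_of_lt hs.2 (hJ ⟨hab, le_rfl⟩))
    refine ⟨min s' b, lt_min hlt hs.2, fun x hx => ?_⟩
    have hxs : x < s' := hx.2.trans_le (min_le_left _ _)
    have hxb : x < b := hx.2.trans_le (min_le_right _ _)
    have hder : ∀ y ∈ Ioo s x, ∃ v ∈ S.velocities (γ y),
        HasDerivAt (fun s => G (γ s)) (derivAlong G (γ y) v) y := fun y hy => by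
      obtain ⟨v, hv, hd⟩ := hp.exists_hasMFDerivAt ⟨hy.1, hy.2.trans hxs⟩
      exact ⟨v, hv, hasDerivAt_comp_of_hasMFDerivAt
        (hG _ (hmaps ⟨hs.1.trans hy.1.le, (hy.2.trans hxb).le⟩)) hd⟩
    have := (convex_Icc s x).mul_sub_le_image_sub_of_le_deriv (f := fun s => G (γ s)) (C := c)
      (hGγ.mono (Icc_subset_Icc hs.1 hxb.le))
      (by
        rw [interior_Icc]
        intro y hy
        obtain ⟨v, -, hd⟩ := hder y hy
        exact hd.differentiableAt.differentiableWithinAt)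
      (by
        rw [interior_Icc]
        intro y hy
        obtain ⟨v, hv, hd⟩ := hder y hy
        rw [hd.deriv]
        exact hc _ (hmaps ⟨hs.1.trans hy.1.le, (hy.2.trans hxb).le⟩) v hv)
      s ⟨le_rfl, hx.1.le⟩ x ⟨hx.1.le, le_rfl⟩ hx.1.le
    linarith
  linarith

/-- The mean value inequality on an interval whose endpoints may be exceptional. -/
lemma SatisfiesMeanValue.le_of_Ioo {S : FilippovSystem I M r} {γ : ℝ → M} {J : Set ℝ}
    (h : S.SatisfiesMeanValue γ J) {a b : ℝ} (hab : a ≤ b) (hJ : Ioo a b ⊆ J) {N : Set M}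
    (hN : IsOpen N) (hmaps : MapsTo γ (Ioo a b) N) (hdisj : Disjoint N S.tangency) {G : M → ℝ}
    (hG : ∀ q ∈ N, MDifferentiableAt I 𝓘(ℝ, ℝ) G q)
    (hGγ : ContinuousOn (fun s => G (γ s)) (Icc a b)) {c : ℝ}
    (hc : ∀ q ∈ N, ∀ v ∈ S.velocities q, c ≤ derivAlong G q v) :
    c * (b - a) ≤ G (γ b) - G (γ a) := by
  rcases hab.eq_or_lt with rfl | hlt
  · simp
  have hne : (𝓝[Ioo a b] a).NeBot := left_nhdsWithin_Ioo_neBot hlt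
  have hne' : (𝓝[Ioo a b] b).NeBot := right_nhdsWithin_Ioo_neBot hlt
  have step : ∀ x ∈ Ioo a b, c * (b - x) ≤ G (γ b) - G (γ x) := fun x hx => by
    have h1 : Tendsto (fun y => G (γ y) - G (γ x) - c * (y - x)) (𝓝[Ioo a b] b)
        (𝓝 (G (γ b) - G (γ x) - c * (b - x))) :=
      (((hGγ b ⟨hab, le_rfl⟩).mono Ioo_subset_Icc_self).sub_const _).sub
        ((by fun_prop : Continuous fun y : ℝ => c * (y - x)).continuousWithinAt)
    have h2 := ge_of_tendsto (b := 0) h1 (by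
      filter_upwards [self_mem_nhdsWithin, mem_nhdsWithin_of_mem_nhds (Ioi_mem_nhds hx.2)]
        with y hy hxy
      have := h x y (mem_Ioi.1 hxy).le ((Icc_subset_Ioo hx.1 hy.2).trans hJ) N hN
        (hmaps.mono_left (Icc_subset_Ioo hx.1 hy.2)) hdisj G hG c hc
      linarith)
    linarith
  have h1 : Tendsto (fun x => G (γ b) - G (γ x) - c * (b - x)) (𝓝[Ioo a b] a)
      (𝓝 (G (γ b) - G (γ a) - c * (b - a))) :=
    (((hGγ a ⟨le_rfl, hab⟩).mono Ioo_subset_Icc_self).const_sub _).sub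
      ((by fun_prop : Continuous fun y : ℝ => c * (b - y)).continuousWithinAt)
  have h2 := ge_of_tendsto (b := 0) h1 (by
    filter_upwards [self_mem_nhdsWithin] with x hx
    have := step x hx
    linarith)
  linarith

end FilippovSystem

namespace FilippovSystem

variable {E : Type*} [NormedAddCommGroup E] [NormedSpace ℝ E]
  {H : Type*} [TopologicalSpace H] {I : ModelWithCorners ℝ E H}
  {M : Type*} [TopologicalSpace M] [ChartedSpace H M] [IsManifold I ∞ M] {r : ℕ∞}

lemma contMDiff_one_h (S : FilippovSystem I M r) (hr : 1 ≤ r) : ContMDiff I 𝓘(ℝ, ℝ) 1 S.h :=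
  S.contMDiff_h.of_le (by exact_mod_cast hr)

lemma mdifferentiableAt_h (S : FilippovSystem I M r) (hr : 1 ≤ r) (q : M) :
    MDifferentiableAt I 𝓘(ℝ, ℝ) S.h q :=
  (S.contMDiff_one_h hr).mdifferentiableAt one_ne_zero

lemma continuous_lie_Zp (S : FilippovSystem I M r) (hr : 1 ≤ r) : Continuous (S.lie S.Zp) := by
  have : IsManifold I 1 M := IsManifold.of_le (n := ∞) (by simp)
  exact continuousOn_univ.1 (continuousOn_derivAlong isOpen_univ
    (S.contMDiff_one_h hr).contMDiffOn S.contMDiff_Zp.continuous)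

lemma continuous_lie_Zm (S : FilippovSystem I M r) (hr : 1 ≤ r) : Continuous (S.lie S.Zm) := by
  have : IsManifold I 1 M := IsManifold.of_le (n := ∞) (by simp)
  exact continuousOn_univ.1 (continuousOn_derivAlong isOpen_univ
    (S.contMDiff_one_h hr).contMDiffOn S.contMDiff_Zm.continuous)

lemma continuousAt_derivAlong_extChartAt (p : M) {X : (q : M) → TangentSpace I q}
    (hX : Continuous fun q => (⟨q, X q⟩ : TangentBundle I M)) :
    ContinuousAt (fun q => derivAlong (extChartAt I p) q (X q)) p := by
  have : IsManifold I 1 M := IsManifold.of_le (n := ∞) (by simp)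
  exact (continuousOn_derivAlong (chartAt H p).open_source contMDiffOn_extChartAt hX).continuousAt
    ((chartAt H p).open_source.mem_nhds (mem_chart_source H p))

/-- A convex condition on derivatives holds for all velocities if it holds for `Z₊` and `Z₋`. -/
lemma derivAlong_mem_of_convex {F : Type*} [NormedAddCommGroup F] [NormedSpace ℝ F]
    (S : FilippovSystem I M r) {G : M → F} {q : M} {K : Set F}
    (hK : Convex ℝ K) (hp : derivAlong G q (S.Zp q) ∈ K) (hm : derivAlong G q (S.Zm q) ∈ K)
    {v : TangentSpace I q} (hv : v ∈ S.velocities q) : derivAlong G q v ∈ K := by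
  rcases hv with ⟨-, rfl⟩ | ⟨-, rfl⟩ | ⟨hs, rfl⟩
  · exact hp
  · exact hm
  · obtain ⟨s, t, hs0, ht0, hst, he⟩ := S.exists_Zs_eq hs
    rw [he, derivAlong_add_smul]
    exact hK hp hm hs0 ht0 hst

lemma derivAlong_Zs {F : Type*} [NormedAddCommGroup F] [NormedSpace ℝ F]
    (S : FilippovSystem I M r) (G : M → F) (q : M) :
    derivAlong G q (S.Zs q) = (1 / (S.lie S.Zm q - S.lie S.Zp q)) •
      (S.lie S.Zm q • derivAlong G q (S.Zp q) - S.lie S.Zp q • derivAlong G q (S.Zm q)) := by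
  unfold derivAlong Zs
  rw [map_smul, map_sub, map_smul, map_smul]
  rfl

/-- If, near a point of a curve satisfying the mean value inequality, all velocities agree with `v₀`
up to multiples of a vector `D` given by their component transverse to the level of `h`, and the
curve stays on the level `h = 0` unless `D = 0`, then the curve has velocity `v₀`. -/
lemma SatisfiesMeanValue.hasMFDerivAt {S : FilippovSystem I M r} (hr : 1 ≤ r)
    (htan : IsClosed S.tangency) {γ : ℝ → M} {J : Set ℝ} (h : S.SatisfiesMeanValue γ J) {s : ℝ}
    (hJ : J ∈ 𝓝 s) (hγ : ContinuousOn γ J) (hs : γ s ∉ S.tangency) {D : E}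
    {v₀ : TangentSpace I (γ s)}
    (hD : ∀ᶠ x in 𝓝 s, S.h (γ x) • D = 0)
    (hlim : ∀ ε > 0, ∀ᶠ q in 𝓝 (γ s), ∀ v ∈ S.velocities q,
      ‖derivAlong (extChartAt I (γ s)) q v - derivAlong S.h q v • D - derivAlong (extChartAt I (γ s)) (γ s) v₀‖ ≤ ε) :
    HasMFDerivAt 𝓘(ℝ, ℝ) I γ s ((1 : ℝ →L[ℝ] ℝ).smulRight v₀) := by
  have : IsManifold I 1 M := IsManifold.of_le (n := ∞) (by simp)
  have hγs : ContinuousAt γ s := hγ.continuousAt hJ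
  set φ := extChartAt I (γ s) with hφ
  set X₀ : E := derivAlong φ (γ s) v₀ with hX₀
  suffices hd : HasDerivAt (φ ∘ γ) X₀ s by
    have hv₀ : X₀ = v₀ := derivAlong_extChartAt_self _ _
    refine ⟨hγs, ?_⟩
    have hd' := hd.hasFDerivAt.hasFDerivWithinAt (s := univ)
    have hL : ContinuousLinearMap.toSpanSingleton ℝ X₀ =
        (1 : ℝ →L[ℝ] ℝ).smulRight (v₀ : E) := by rw [hv₀]; rfl
    rw [hL] at hd'
    simpa only [writtenInExtChartAt, extChartAt_model_space_eq_id, mfld_simps] using! hd'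
  rw [hasDerivAt_iff_isLittleO, Asymptotics.isLittleO_iff]
  intro ε hε
  have hgood := (hlim ε hε).and (((chartAt H (γ s)).open_source.eventually_mem
    (mem_chart_source H (γ s))).and (htan.isOpen_compl.eventually_mem hs))
  obtain ⟨N, hN, hNo, hsN⟩ := eventually_nhds_iff.1 hgood
  obtain ⟨δ, hδ, hball⟩ := Metric.mem_nhds_iff.1
    (inter_mem (inter_mem hJ (hγs.preimage_mem_nhds (hNo.mem_nhds hsN))) hD)
  have key : ∀ ℓ : E →L[ℝ] ℝ, ‖ℓ‖ ≤ 1 → ∀ x ∈ Metric.ball s δ, ∀ y ∈ Metric.ball s δ, x ≤ y →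
      (ℓ X₀ - ε) * (y - x) ≤ ℓ (φ (γ y)) - ℓ (φ (γ x)) := by
    intro ℓ hℓ x hx y hy hxy
    have hsub : Icc x y ⊆ Metric.ball s δ := by
      rw [Real.ball_eq_Ioo] at hx hy ⊢
      exact Icc_subset_Ioo hx.1 hy.2
    have hG : ∀ q ∈ N, MDifferentiableAt I 𝓘(ℝ, E) φ q := fun q hq =>
      mdifferentiableAt_extChartAt (hN q hq).2.1
    have := h x y hxy (fun z hz => (hball (hsub hz)).1.1) N hNo (fun z hz => (hball (hsub hz)).1.2)
      (disjoint_left.2 fun q hq => (hN q hq).2.2) (fun q => ℓ (φ q - S.h q • D))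
      (fun q hq => (derivAlong_comp_sub (hG q hq) (S.mdifferentiableAt_h hr q) ℓ D).1)
      (ℓ X₀ - ε) (fun q hq v hv => by
        rw [(derivAlong_comp_sub (hG q hq) (S.mdifferentiableAt_h hr q) ℓ D).2 v]
        have h1 := (hN q hq).1 v hv
        have h2 := (ℓ.le_opNorm (derivAlong φ q v - derivAlong S.h q v • D - X₀)).trans
          (mul_le_of_le_one_left (norm_nonneg _) hℓ)
        rw [Real.norm_eq_abs, map_sub] at h2
        linarith [(abs_le.1 (h2.trans h1)).1])
    have hx0 : S.h (γ x) • D = 0 := (hball hx).2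
    have hy0 : S.h (γ y) • D = 0 := (hball hy).2
    simpa only [hx0, hy0, sub_zero] using this
  filter_upwards [Metric.ball_mem_nhds s hδ] with x hx
  obtain ⟨ℓ, hℓ, hℓx⟩ := exists_dual_vector'' ℝ ((φ ∘ γ) x - (φ ∘ γ) s - (x - s) • X₀)
  have hℓx' : ‖(φ ∘ γ) x - (φ ∘ γ) s - (x - s) • X₀‖ =
      ℓ (φ (γ x)) - ℓ (φ (γ s)) - (x - s) * ℓ X₀ := by
    rw [map_sub, map_sub, map_smul] at hℓx
    exact hℓx.symm
  rw [hℓx', Real.norm_eq_abs]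
  have hsδ := Metric.mem_ball_self (x := s) hδ
  rcases le_total s x with hsx | hxs
  · have := key (-ℓ) (by rwa [norm_neg]) s hsδ x hx hsx
    simp only [neg_apply] at this
    rw [abs_of_nonneg (sub_nonneg.2 hsx)]
    linarith
  · have := key ℓ hℓ x hx s hsδ hxs
    rw [abs_of_nonpos (sub_nonpos.2 hxs)]
    linarith

lemma SatisfiesMeanValue.mono {S : FilippovSystem I M r} {γ : ℝ → M} {J J' : Set ℝ}
    (h : S.SatisfiesMeanValue γ J) (hJ : J' ⊆ J) : S.SatisfiesMeanValue γ J' :=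
  fun a b hab hsub => h a b hab (hsub.trans hJ)

section Pieces

variable {S : FilippovSystem I M r} {γ : ℝ → M} {a b : ℝ}

lemma SatisfiesMeanValue.isPiece_of_pos (h : S.SatisfiesMeanValue γ (Ioo a b)) (hr : 1 ≤ r)
    (htan : IsClosed S.tangency) (hγ : ContinuousOn γ (Ioo a b))
    (hpos : ∀ t ∈ Ioo a b, 0 < S.h (γ t)) : S.IsPiece γ a b := by
  refine Or.inl ⟨hpos, fun s hs => HasMFDerivAt.hasMFDerivWithinAt ?_⟩
  have hs0 := hpos s hs
  refine h.hasMFDerivAt hr htan (Ioo_mem_nhds hs.1 hs.2) hγ (fun ht => hs0.ne' ht.1) (D := 0)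
    (by simp) fun ε hε => ?_
  have hc := continuousAt_derivAlong_extChartAt (γ s) S.contMDiff_Zp.continuous
  have h1 := Metric.continuousAt_iff'.1 hc ε hε
  filter_upwards [h1, (S.contMDiff_h.continuous.continuousAt.eventually (lt_mem_nhds hs0))]
    with q hq hq0 v hv
  have hvq : v = S.Zp q := by
    rcases hv with ⟨-, hv⟩ | ⟨hn, -⟩ | ⟨hn, -⟩
    · exact hv
    · exact absurd hn (not_lt.2 hq0.le)
    · exact absurd hn.1 hq0.ne'
  rw [dist_eq_norm] at hq
  rw [hvq, smul_zero, sub_zero]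
  exact hq.le

lemma SatisfiesMeanValue.isPiece_of_neg (h : S.SatisfiesMeanValue γ (Ioo a b)) (hr : 1 ≤ r)
    (htan : IsClosed S.tangency) (hγ : ContinuousOn γ (Ioo a b))
    (hneg : ∀ t ∈ Ioo a b, S.h (γ t) < 0) : S.IsPiece γ a b := by
  refine Or.inr (Or.inl ⟨hneg, fun s hs => HasMFDerivAt.hasMFDerivWithinAt ?_⟩)
  have hs0 := hneg s hs
  refine h.hasMFDerivAt hr htan (Ioo_mem_nhds hs.1 hs.2) hγ (fun ht => hs0.ne ht.1) (D := 0)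
    (by simp) fun ε hε => ?_
  have hc := continuousAt_derivAlong_extChartAt (γ s) S.contMDiff_Zm.continuous
  have h1 := Metric.continuousAt_iff'.1 hc ε hε
  filter_upwards [h1, (S.contMDiff_h.continuous.continuousAt.eventually (gt_mem_nhds hs0))]
    with q hq hq0 v hv
  have hvq : v = S.Zm q := by
    rcases hv with ⟨hn, -⟩ | ⟨-, hv⟩ | ⟨hn, -⟩
    · exact absurd hn (not_lt.2 hq0.le)
    · exact hv
    · exact absurd hn.1 hq0.ne
  rw [dist_eq_norm] at hq
  rw [hvq, smul_zero, sub_zero]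
  exact hq.le

lemma lie_sub_ne_zero {p : M} (hp : p ∈ S.sliding) : S.lie S.Zm p - S.lie S.Zp p ≠ 0 := fun h0 => by
  have h1 := hp.2
  rw [sub_eq_zero.1 h0] at h1
  exact absurd h1 (not_lt.2 (mul_self_nonneg _))

lemma SatisfiesMeanValue.isPiece_of_sliding (h : S.SatisfiesMeanValue γ (Ioo a b)) (hr : 1 ≤ r)
    (htan : IsClosed S.tangency) (hγ : ContinuousOn γ (Ioo a b))
    (hsl : ∀ t ∈ Ioo a b, γ t ∈ S.sliding) : S.IsPiece γ a b := by
  refine Or.inr (Or.inr ⟨hsl, fun s hs => HasMFDerivAt.hasMFDerivWithinAt ?_⟩)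
  have hps := hsl s hs
  set p := γ s with hp
  set x := S.lie S.Zp p with hx
  set y := S.lie S.Zm p with hy
  have hne : y - x ≠ 0 := lie_sub_ne_zero hps
  set u : E := derivAlong (extChartAt I p) p (S.Zp p) with hu
  set w : E := derivAlong (extChartAt I p) p (S.Zm p) with hw
  let D : E := (1 / (y - x)) • (w - u)
  have hZs : derivAlong (extChartAt I p) p (S.Zs p) = (1 / (y - x)) • (y • u - x • w) :=
    S.derivAlong_Zs _ _
  refine h.hasMFDerivAt hr htan (Ioo_mem_nhds hs.1 hs.2) hγ (fun ht => hps.2.ne ht.2) (D := D)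
    ?_ fun ε hε => ?_
  · filter_upwards [Ioo_mem_nhds hs.1 hs.2] with t ht
    rw [show S.h (γ t) = 0 from (hsl t ht).1, zero_smul]
  have hcp : ContinuousAt (fun q => derivAlong (extChartAt I p) q (S.Zp q) - S.lie S.Zp q • D) p :=
    (continuousAt_derivAlong_extChartAt p S.contMDiff_Zp.continuous).sub
      ((S.continuous_lie_Zp hr).continuousAt.smul continuousAt_const)
  have hcm : ContinuousAt (fun q => derivAlong (extChartAt I p) q (S.Zm q) - S.lie S.Zm q • D) p :=
    (continuousAt_derivAlong_extChartAt p S.contMDiff_Zm.continuous).sub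
      ((S.continuous_lie_Zm hr).continuousAt.smul continuousAt_const)
  have e1 : u - x • D = derivAlong (extChartAt I p) p (S.Zs p) := by
    rw [hZs]
    simp only [D, smul_sub, smul_smul]
    match_scalars <;> field_simp
    all_goals ring
  have e2 : w - y • D = derivAlong (extChartAt I p) p (S.Zs p) := by
    rw [hZs]
    simp only [D, smul_sub, smul_smul]
    match_scalars <;> field_simp
    all_goals ring
  filter_upwards [Metric.continuousAt_iff'.1 hcp ε hε, Metric.continuousAt_iff'.1 hcm ε hε]
    with q hq1 hq2 v hv
  rw [dist_eq_norm, ← hx, ← hu, e1] at hq1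
  rw [dist_eq_norm, ← hy, ← hw, e2] at hq2
  rcases hv with ⟨-, rfl⟩ | ⟨-, rfl⟩ | ⟨hq, rfl⟩
  · exact hq1.le
  · exact hq2.le
  · obtain ⟨σ, τ, hσ, hτ, hστ, he⟩ := S.exists_Zs_eq hq
    rw [he, derivAlong_add_smul, derivAlong_add_smul]
    have hmem := convex_closedBall (derivAlong (extChartAt I p) p (S.Zs p)) ε
      (mem_closedBall_iff_norm.2 hq1.le) (mem_closedBall_iff_norm.2 hq2.le) hσ hτ hστ
    rw [mem_closedBall_iff_norm] at hmem
    refine le_of_eq_of_le (congrArg norm ?_) hmem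
    change σ • _ + τ • _ - (σ * S.lie S.Zp q + τ * S.lie S.Zm q) • D - _ = _
    module

end Pieces

end FilippovSystem

namespace FilippovSystem

variable {E : Type*} [NormedAddCommGroup E] [NormedSpace ℝ E]
  {H : Type*} [TopologicalSpace H] {I : ModelWithCorners ℝ E H}
  {M : Type*} [TopologicalSpace M] [ChartedSpace H M] [IsManifold I ∞ M] {r : ℕ∞}
  {S : FilippovSystem I M r} {γ : ℝ → M} {J : Set ℝ}

lemma forall_pos_or_forall_neg {f : ℝ → ℝ} {a b : ℝ} (hf : ContinuousOn f (Ioo a b))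
    (h0 : ∀ t ∈ Ioo a b, f t ≠ 0) : (∀ t ∈ Ioo a b, 0 < f t) ∨ ∀ t ∈ Ioo a b, f t < 0 := by
  by_contra! hcon
  obtain ⟨⟨x, hx, hfx⟩, y, hy, hfy⟩ := hcon
  obtain ⟨z, hz, hz0⟩ := isPreconnected_Ioo.intermediate_value hx hy hf ⟨hfx, hfy⟩
  exact h0 z hz hz0

/-- Near a point of the switching manifold that is not a tangency point, either all velocities
point to the same side, or `h ^ 2` is monotone along trajectories and all points of the switching
manifold are sliding points. -/
lemma SatisfiesMeanValue.exists_nhds_level (h : S.SatisfiesMeanValue γ J) (hr : 1 ≤ r)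
    (htan : IsClosed S.tangency) {p : M} (hp : S.h p = 0) (hpt : p ∉ S.tangency) :
    ∃ N : Set M, IsOpen N ∧ p ∈ N ∧ Disjoint N S.tangency ∧
      ((∀ s u, s < u → Icc s u ⊆ J → MapsTo γ (Icc s u) N → S.h (γ s) < S.h (γ u)) ∨
      (∀ s u, s < u → Icc s u ⊆ J → MapsTo γ (Icc s u) N → S.h (γ u) < S.h (γ s)) ∨
      ((∀ q ∈ N, S.h q = 0 → q ∈ S.sliding) ∧
        ∀ s u, s ≤ u → Icc s u ⊆ J → MapsTo γ (Icc s u) N → S.h (γ u) ^ 2 ≤ S.h (γ s) ^ 2) ∨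
      ((∀ q ∈ N, S.h q = 0 → q ∈ S.sliding) ∧
        ∀ s u, s ≤ u → Icc s u ⊆ J → MapsTo γ (Icc s u) N → S.h (γ s) ^ 2 ≤ S.h (γ u) ^ 2)) := by
  have hx := S.continuous_lie_Zp hr
  have hy := S.continuous_lie_Zm hr
  have hne : S.lie S.Zp p * S.lie S.Zm p ≠ 0 := fun h0 => hpt ⟨hp, h0⟩
  have hpx := left_ne_zero_of_mul hne
  have hpy := right_ne_zero_of_mul hne
  have hsq : ∀ (c : ℝ) (N : Set M), IsOpen N → Disjoint N S.tangency →
      (∀ q ∈ N, 0 ≤ c * S.lie S.Zp q ∧ c * S.lie S.Zm q ≤ 0) →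
      ∀ s u, s ≤ u → Icc s u ⊆ J → MapsTo γ (Icc s u) N →
      c * S.h (γ s) ^ 2 ≤ c * S.h (γ u) ^ 2 := by
    intro c N hNo hNt hN s u hsu hJ hmaps
    have := h s u hsu hJ N hNo hmaps hNt (fun x => c * S.h x ^ 2)
      (fun q _ => (derivAlong_const_mul_sq (S.mdifferentiableAt_h hr q) c).1) 0 (fun q hq v hv => by
        rw [(derivAlong_const_mul_sq (S.mdifferentiableAt_h hr q) c).2 v]
        rcases hv with ⟨h0, rfl⟩ | ⟨h0, rfl⟩ | ⟨h0, rfl⟩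
        · have h1 : 0 ≤ c * derivAlong S.h q (S.Zp q) := (hN q hq).1
          nlinarith
        · have h1 : c * derivAlong S.h q (S.Zm q) ≤ 0 := (hN q hq).2
          nlinarith
        · rw [show S.h q = 0 from h0.1]
          simp)
    linarith
  have hlin : ∀ (c : ℝ) (N : Set M), IsOpen N → Disjoint N S.tangency → ∀ ε > 0,
      (∀ q ∈ N, ε ≤ c * S.lie S.Zp q ∧ ε ≤ c * S.lie S.Zm q) →
      ∀ s u, s < u → Icc s u ⊆ J → MapsTo γ (Icc s u) N → c * S.h (γ s) < c * S.h (γ u) := by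
    intro c N hNo hNt ε hε hN s u hsu hJ hmaps
    have := h s u hsu.le hJ N hNo hmaps hNt (fun x => c * S.h x)
      (fun q _ => (derivAlong_const_mul (S.mdifferentiableAt_h hr q) c).1) ε (fun q hq v hv => by
        have hd := (derivAlong_const_mul (S.mdifferentiableAt_h hr q) c).2
        refine S.derivAlong_mem_of_convex (convex_Ici ε) ?_ ?_ hv
        · rw [hd]; exact (hN q hq).1
        · rw [hd]; exact (hN q hq).2)
    have h2 := mul_pos hε (sub_pos.2 hsu)
    linarith
  have hopen : ∀ P : M → Prop, (∀ᶠ q in 𝓝 p, P q) → ∃ N : Set M, IsOpen N ∧ p ∈ N ∧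
      Disjoint N S.tangency ∧ ∀ q ∈ N, P q := fun P hP => by
    obtain ⟨N, hN, hNo, hpN⟩ := eventually_nhds_iff.1 (hP.and (htan.isOpen_compl.eventually_mem hpt))
    exact ⟨N, hNo, hpN, disjoint_left.2 fun q hq => (hN q hq).2, fun q hq => (hN q hq).1⟩
  rcases hpx.lt_or_gt with hx0 | hx0 <;> rcases hpy.lt_or_gt with hy0 | hy0
  · obtain ⟨N, hNo, hpN, hNt, hN⟩ := hopen
      (fun q => S.lie S.Zp q < S.lie S.Zp p / 2 ∧ S.lie S.Zm q < S.lie S.Zm p / 2)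
      ((hx.continuousAt.eventually (gt_mem_nhds (by linarith))).and
        (hy.continuousAt.eventually (gt_mem_nhds (by linarith))))
    refine ⟨N, hNo, hpN, hNt, Or.inr (Or.inl fun s u hsu hJ hm => ?_)⟩
    have := hlin (-1) N hNo hNt (min (-(S.lie S.Zp p / 2)) (-(S.lie S.Zm p / 2)))
      (lt_min (by linarith) (by linarith)) (fun q hq => ⟨(min_le_left _ _).trans
        (by linarith [(hN q hq).1]), (min_le_right _ _).trans (by linarith [(hN q hq).2])⟩)
      s u hsu hJ hm
    linarith
  · obtain ⟨N, hNo, hpN, hNt, hN⟩ := hopen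
      (fun q => S.lie S.Zp q < 0 ∧ 0 < S.lie S.Zm q)
      ((hx.continuousAt.eventually (gt_mem_nhds hx0)).and
        (hy.continuousAt.eventually (lt_mem_nhds hy0)))
    refine ⟨N, hNo, hpN, hNt, Or.inr (Or.inr (Or.inl ⟨fun q hq h0 => ⟨h0,
      mul_neg_of_neg_of_pos (hN q hq).1 (hN q hq).2⟩, fun s u hsu hJ hm => ?_⟩))⟩
    have := hsq (-1) N hNo hNt (fun q hq => ⟨by linarith [(hN q hq).1], by linarith [(hN q hq).2]⟩)
      s u hsu hJ hm
    linarith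
  · obtain ⟨N, hNo, hpN, hNt, hN⟩ := hopen
      (fun q => 0 < S.lie S.Zp q ∧ S.lie S.Zm q < 0)
      ((hx.continuousAt.eventually (lt_mem_nhds hx0)).and
        (hy.continuousAt.eventually (gt_mem_nhds hy0)))
    refine ⟨N, hNo, hpN, hNt, Or.inr (Or.inr (Or.inr ⟨fun q hq h0 => ⟨h0,
      mul_neg_of_pos_of_neg (hN q hq).1 (hN q hq).2⟩, fun s u hsu hJ hm => ?_⟩))⟩
    have := hsq 1 N hNo hNt (fun q hq => ⟨by linarith [(hN q hq).1], by linarith [(hN q hq).2]⟩)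
      s u hsu hJ hm
    linarith
  · obtain ⟨N, hNo, hpN, hNt, hN⟩ := hopen
      (fun q => S.lie S.Zp p / 2 < S.lie S.Zp q ∧ S.lie S.Zm p / 2 < S.lie S.Zm q)
      ((hx.continuousAt.eventually (lt_mem_nhds (by linarith))).and
        (hy.continuousAt.eventually (lt_mem_nhds (by linarith))))
    refine ⟨N, hNo, hpN, hNt, Or.inl fun s u hsu hJ hm => ?_⟩
    have := hlin 1 N hNo hNt (min (S.lie S.Zp p / 2) (S.lie S.Zm p / 2))
      (lt_min (by linarith) (by linarith)) (fun q hq => ⟨(min_le_left _ _).trans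
        (by linarith [(hN q hq).1]), (min_le_right _ _).trans (by linarith [(hN q hq).2])⟩)
      s u hsu hJ hm
    linarith

/-- A curve that satisfies the mean value inequality starts a smooth piece at every time at which it
is not at a tangency point. -/
lemma SatisfiesMeanValue.exists_piece_right (h : S.SatisfiesMeanValue γ J) (hr : 1 ≤ r)
    (htan : IsClosed S.tangency) (hγ : ContinuousOn γ J) {t u : ℝ} (htu : t < u)
    (hJ : Icc t u ⊆ J) (ht : γ t ∉ S.tangency) :
    ∃ b, t < b ∧ Icc t b ⊆ J ∧ S.IsPiece γ t b := by
  have hh := S.contMDiff_h.continuous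
  have small : ∀ N : Set M, IsOpen N → γ t ∈ N →
      ∃ b, t < b ∧ Icc t b ⊆ J ∧ MapsTo γ (Icc t b) N := fun N hN htN => by
    have h1 : ContinuousWithinAt γ (Icc t u) t := (hγ.mono hJ) t ⟨le_rfl, htu.le⟩
    have h2 := h1.preimage_mem_nhdsWithin (hN.mem_nhds htN)
    rw [nhdsWithin_Icc_eq_nhdsGE htu, mem_nhdsGE_iff_exists_Icc_subset] at h2
    obtain ⟨b, hb, hsub⟩ := h2
    exact ⟨min b u, lt_min hb htu, (Icc_subset_Icc_right (min_le_right _ _)).trans hJ,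
      fun x hx => hsub (Icc_subset_Icc_right (min_le_left _ _) hx)⟩
  have mv : ∀ {b}, Icc t b ⊆ J → S.SatisfiesMeanValue γ (Ioo t b) :=
    fun hb => h.mono (Ioo_subset_Icc_self.trans hb)
  have cont : ∀ {b}, Icc t b ⊆ J → ContinuousOn γ (Ioo t b) :=
    fun hb => hγ.mono (Ioo_subset_Icc_self.trans hb)
  rcases lt_trichotomy (S.h (γ t)) 0 with h0 | h0 | h0
  · obtain ⟨b, hb, hbJ, hm⟩ := small {q | S.h q < 0} (isOpen_lt hh continuous_const) h0
    exact ⟨b, hb, hbJ, (mv hbJ).isPiece_of_neg hr htan (cont hbJ)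
      fun x hx => hm (Ioo_subset_Icc_self hx)⟩
  · obtain ⟨N, hNo, hpN, -, hcase⟩ := h.exists_nhds_level hr htan h0 ht
    obtain ⟨b, hb, hbJ, hm⟩ := small N hNo hpN
    have sub : ∀ {x y}, t ≤ x → y ≤ b → Icc x y ⊆ J ∧ MapsTo γ (Icc x y) N := fun hx hy =>
      ⟨(Icc_subset_Icc hx hy).trans hbJ, hm.mono_left (Icc_subset_Icc hx hy)⟩
    rcases hcase with hc | hc | ⟨hsl, hc⟩ | ⟨hsl, hc⟩
    · refine ⟨b, hb, hbJ, (mv hbJ).isPiece_of_pos hr htan (cont hbJ) fun x hx => ?_⟩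
      rw [← h0]
      exact hc t x hx.1 (sub le_rfl hx.2.le).1 (sub le_rfl hx.2.le).2
    · refine ⟨b, hb, hbJ, (mv hbJ).isPiece_of_neg hr htan (cont hbJ) fun x hx => ?_⟩
      rw [← h0]
      exact hc t x hx.1 (sub le_rfl hx.2.le).1 (sub le_rfl hx.2.le).2
    · refine ⟨b, hb, hbJ, (mv hbJ).isPiece_of_sliding hr htan (cont hbJ) fun x hx => ?_⟩
      have := hc t x hx.1.le (sub le_rfl hx.2.le).1 (sub le_rfl hx.2.le).2
      rw [h0] at this
      exact hsl _ (hm (Ioo_subset_Icc_self hx)) (by nlinarith)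
    · by_cases hex : ∃ s ∈ Ioo t b, S.h (γ s) = 0
      · obtain ⟨s, hs, hs0⟩ := hex
        have hsJ := (sub le_rfl hs.2.le).1
        refine ⟨s, hs.1, hsJ, (mv hsJ).isPiece_of_sliding hr htan (cont hsJ) fun x hx => ?_⟩
        have := hc x s hx.2.le (sub hx.1.le hs.2.le).1 (sub hx.1.le hs.2.le).2
        rw [hs0] at this
        exact hsl _ (hm ⟨hx.1.le, (hx.2.trans hs.2).le⟩) (by nlinarith)
      · push Not at hex
        refine ⟨b, hb, hbJ, ?_⟩
        rcases forall_pos_or_forall_neg (hh.comp_continuousOn (cont hbJ)) hex with hs | hs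
        · exact (mv hbJ).isPiece_of_pos hr htan (cont hbJ) hs
        · exact (mv hbJ).isPiece_of_neg hr htan (cont hbJ) hs
  · obtain ⟨b, hb, hbJ, hm⟩ := small {q | 0 < S.h q} (isOpen_lt continuous_const hh) h0
    exact ⟨b, hb, hbJ, (mv hbJ).isPiece_of_pos hr htan (cont hbJ)
      fun x hx => hm (Ioo_subset_Icc_self hx)⟩

/-- A curve that satisfies the mean value inequality ends a smooth piece at every time at which it
is not at a tangency point. -/
lemma SatisfiesMeanValue.exists_piece_left (h : S.SatisfiesMeanValue γ J) (hr : 1 ≤ r)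
    (htan : IsClosed S.tangency) (hγ : ContinuousOn γ J) {t u : ℝ} (hut : u < t)
    (hJ : Icc u t ⊆ J) (ht : γ t ∉ S.tangency) :
    ∃ a, a < t ∧ Icc a t ⊆ J ∧ S.IsPiece γ a t := by
  have hh := S.contMDiff_h.continuous
  have small : ∀ N : Set M, IsOpen N → γ t ∈ N →
      ∃ a, a < t ∧ Icc a t ⊆ J ∧ MapsTo γ (Icc a t) N := fun N hN htN => by
    have h1 : ContinuousWithinAt γ (Icc u t) t := (hγ.mono hJ) t ⟨hut.le, le_rfl⟩
    have h2 := h1.preimage_mem_nhdsWithin (hN.mem_nhds htN)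
    rw [nhdsWithin_Icc_eq_nhdsLE hut, mem_nhdsLE_iff_exists_Icc_subset] at h2
    obtain ⟨a, ha, hsub⟩ := h2
    exact ⟨max a u, max_lt ha hut, (Icc_subset_Icc_left (le_max_right _ _)).trans hJ,
      fun x hx => hsub (Icc_subset_Icc_left (le_max_left _ _) hx)⟩
  have mv : ∀ {a}, Icc a t ⊆ J → S.SatisfiesMeanValue γ (Ioo a t) :=
    fun ha => h.mono (Ioo_subset_Icc_self.trans ha)
  have cont : ∀ {a}, Icc a t ⊆ J → ContinuousOn γ (Ioo a t) :=
    fun ha => hγ.mono (Ioo_subset_Icc_self.trans ha)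
  rcases lt_trichotomy (S.h (γ t)) 0 with h0 | h0 | h0
  · obtain ⟨a, ha, haJ, hm⟩ := small {q | S.h q < 0} (isOpen_lt hh continuous_const) h0
    exact ⟨a, ha, haJ, (mv haJ).isPiece_of_neg hr htan (cont haJ)
      fun x hx => hm (Ioo_subset_Icc_self hx)⟩
  · obtain ⟨N, hNo, hpN, -, hcase⟩ := h.exists_nhds_level hr htan h0 ht
    obtain ⟨a, ha, haJ, hm⟩ := small N hNo hpN
    have sub : ∀ {x y}, a ≤ x → y ≤ t → Icc x y ⊆ J ∧ MapsTo γ (Icc x y) N := fun hx hy =>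
      ⟨(Icc_subset_Icc hx hy).trans haJ, hm.mono_left (Icc_subset_Icc hx hy)⟩
    rcases hcase with hc | hc | ⟨hsl, hc⟩ | ⟨hsl, hc⟩
    · refine ⟨a, ha, haJ, (mv haJ).isPiece_of_neg hr htan (cont haJ) fun x hx => ?_⟩
      rw [← h0]
      exact hc x t hx.2 (sub hx.1.le le_rfl).1 (sub hx.1.le le_rfl).2
    · refine ⟨a, ha, haJ, (mv haJ).isPiece_of_pos hr htan (cont haJ) fun x hx => ?_⟩
      rw [← h0]
      exact hc x t hx.2 (sub hx.1.le le_rfl).1 (sub hx.1.le le_rfl).2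
    · by_cases hex : ∃ s ∈ Ioo a t, S.h (γ s) = 0
      · obtain ⟨s, hs, hs0⟩ := hex
        have hsJ := (sub hs.1.le le_rfl).1
        refine ⟨s, hs.2, hsJ, (mv hsJ).isPiece_of_sliding hr htan (cont hsJ) fun x hx => ?_⟩
        have := hc s x hx.1.le (sub hs.1.le hx.2.le).1 (sub hs.1.le hx.2.le).2
        rw [hs0] at this
        exact hsl _ (hm ⟨(hs.1.trans hx.1).le, hx.2.le⟩) (by nlinarith)
      · push Not at hex
        refine ⟨a, ha, haJ, ?_⟩
        rcases forall_pos_or_forall_neg (hh.comp_continuousOn (cont haJ)) hex with hs | hs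
        · exact (mv haJ).isPiece_of_pos hr htan (cont haJ) hs
        · exact (mv haJ).isPiece_of_neg hr htan (cont haJ) hs
    · refine ⟨a, ha, haJ, (mv haJ).isPiece_of_sliding hr htan (cont haJ) fun x hx => ?_⟩
      have := hc x t hx.2.le (sub hx.1.le le_rfl).1 (sub hx.1.le le_rfl).2
      rw [h0] at this
      exact hsl _ (hm (Ioo_subset_Icc_self hx)) (by nlinarith)
  · obtain ⟨a, ha, haJ, hm⟩ := small {q | 0 < S.h q} (isOpen_lt continuous_const hh) h0
    exact ⟨a, ha, haJ, (mv haJ).isPiece_of_pos hr htan (cont haJ)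
      fun x hx => hm (Ioo_subset_Icc_self hx)⟩

end FilippovSystem

namespace FilippovSystem

section Smoothness

variable {E : Type*} [NormedAddCommGroup E] [NormedSpace ℝ E]
  {H : Type*} [TopologicalSpace H] {I : ModelWithCorners ℝ E H}
  {M : Type*} [TopologicalSpace M] [ChartedSpace H M] [IsManifold I ∞ M] {r : ℕ∞}
  {S : FilippovSystem I M r} {γ : ℝ → M}

/-- An integral curve of a vector field that is continuous along it is `C¹`. -/
lemma contMDiffOn_of_isMIntegralCurveOn {X : (q : M) → TangentSpace I q} {a b : ℝ}
    (hi : IsMIntegralCurveOn γ X (Ioo a b))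
    (hX : ∀ p, ContinuousOn (fun t => derivAlong (extChartAt I p) (γ t) (X (γ t)))
      (Ioo a b ∩ γ ⁻¹' (chartAt H p).source)) :
    ContMDiffOn 𝓘(ℝ, ℝ) I 1 γ (Ioo a b) := by
  have : IsManifold I 1 M := IsManifold.of_le (n := ∞) (by simp)
  intro t ht
  refine ContMDiffAt.contMDiffWithinAt ?_
  have hc : ContinuousAt γ t := (hi t ht).1.continuousAt (Ioo_mem_nhds ht.1 ht.2)
  have hnhds : Ioo a b ∩ γ ⁻¹' (chartAt H (γ t)).source ∈ 𝓝 t :=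
    inter_mem (Ioo_mem_nhds ht.1 ht.2) (hc.preimage_mem_nhds (chart_source_mem_nhds H (γ t)))
  rw [contMDiffAt_iff_target]
  refine ⟨hc, contMDiffAt_iff_contDiffAt.2 (contDiffAt_one_iff.2 ⟨_, _, hnhds,
    (ContinuousLinearMap.smulRightL ℝ ℝ E 1).continuous.comp_continuousOn (hX (γ t)),
    fun s hs => ?_⟩)⟩
  have h1 := (hi s hs.1).hasMFDerivAt (Ioo_mem_nhds hs.1.1 hs.1.2)
  exact (hasDerivAt_comp_of_hasMFDerivAt (mdifferentiableAt_extChartAt hs.2) h1).hasFDerivAt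

lemma IsPiece.contMDiffOn {a b : ℝ} (hr : 1 ≤ r) (h : S.IsPiece γ a b) :
    ContMDiffOn 𝓘(ℝ, ℝ) I 1 γ (Ioo a b) := by
  have : IsManifold I 1 M := IsManifold.of_le (n := ∞) (by simp)
  have key : ∀ {X : (q : M) → TangentSpace I q} (p : M),
      Continuous (fun q => (⟨q, X q⟩ : TangentBundle I M)) → ContinuousOn γ (Ioo a b) →
      ContinuousOn (fun t => derivAlong (extChartAt I p) (γ t) (X (γ t)))
        (Ioo a b ∩ γ ⁻¹' (chartAt H p).source) := fun p hX hγ =>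
    (continuousOn_derivAlong (chartAt H p).open_source contMDiffOn_extChartAt hX).comp
      (hγ.mono inter_subset_left) fun t ht => ht.2
  rcases h with ⟨-, hi⟩ | ⟨-, hi⟩ | ⟨hm, hi⟩
  · exact contMDiffOn_of_isMIntegralCurveOn hi fun p =>
      key p S.contMDiff_Zp.continuous hi.continuousOn
  · exact contMDiffOn_of_isMIntegralCurveOn hi fun p =>
      key p S.contMDiff_Zm.continuous hi.continuousOn
  · refine contMDiffOn_of_isMIntegralCurveOn hi fun p => ?_
    simp only [derivAlong_Zs]
    have hγ := hi.continuousOn.mono (inter_subset_left (t := γ ⁻¹' (chartAt H p).source))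
    have h1 := (S.continuous_lie_Zp hr).comp_continuousOn hγ
    have h2 := (S.continuous_lie_Zm hr).comp_continuousOn hγ
    exact (continuousOn_const.div (h2.sub h1) fun t ht => lie_sub_ne_zero (hm ht.1)).smul
      ((h2.smul (key p S.contMDiff_Zp.continuous hi.continuousOn)).sub
        (h1.smul (key p S.contMDiff_Zm.continuous hi.continuousOn)))

/-- The velocities of smooth pieces are values of the multivalued field. -/
lemma velocities_subset_values (S : FilippovSystem I M r) (q : M) :
    S.velocities q ⊆ S.values q := by
  rintro v (⟨h, rfl⟩ | ⟨h, rfl⟩ | ⟨h, rfl⟩)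
  · exact ⟨1, ⟨fun _ => rfl, fun h' => absurd h' (not_lt.2 h.le), fun h' => absurd h' h.ne'⟩,
      by module⟩
  · exact ⟨-1, ⟨fun h' => absurd h' (not_lt.2 h.le), fun _ => rfl, fun h' => absurd h' h.ne⟩,
      by module⟩
  · obtain ⟨s, t, hs, ht, hst, he⟩ := S.exists_Zs_eq h
    have h0 : S.h q = 0 := h.1
    refine ⟨s - t, ⟨fun h' => absurd h0 h'.ne', fun h' => absurd h0 h'.ne,
      fun _ => ⟨by linarith, by linarith⟩⟩, ?_⟩
    obtain rfl : t = 1 - s := by linarith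
    rw [he]
    module

end Smoothness

variable {E : Type*} [NormedAddCommGroup E] [NormedSpace ℝ E]
  {H : Type*} [TopologicalSpace H] {I : ModelWithCorners ℝ E H}
  {M : Type*} [MetricSpace M] [ChartedSpace H M] [IsManifold I ∞ M] {r : ℕ∞}
  [Bundle.RiemannianBundle (fun p : M => TangentSpace I p)]
  {S : FilippovSystem I M r} {γ : ℝ → M} {J : Set ℝ} {C : ℝ}

lemma exists_nonneg_bound (hbdd : S.Bounded) :
    ∃ C : ℝ, 0 ≤ C ∧ ∀ p, ∀ v ∈ S.values p, ‖v‖ ≤ C := by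
  obtain ⟨C, hC⟩ := hbdd
  exact ⟨max C 0, le_max_right _ _, fun p v hv => (hC p v hv).trans (le_max_left _ _)⟩

variable [IsRiemannianManifold I M]

lemma IsPiece.dist_le {a b : ℝ} (hr : 1 ≤ r) (hC0 : 0 ≤ C)
    (hC : ∀ p, ∀ v ∈ S.values p, ‖v‖ ≤ C) (h : S.IsPiece γ a b) {x y : ℝ} (hax : a < x)
    (hxy : x ≤ y) (hyb : y < b) : dist (γ x) (γ y) ≤ C * (y - x) := by
  have hsub : Icc x y ⊆ Ioo a b := Icc_subset_Ioo hax hyb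
  have h1 : edist (γ x) (γ y) ≤ ENNReal.ofReal (C * (y - x)) := by
    rw [IsRiemannianManifold.out (I := I) (γ x) (γ y)]
    refine (Manifold.riemannianEDist_le_pathELength ((h.contMDiffOn hr).mono hsub) rfl rfl
      hxy).trans ?_
    rw [Manifold.pathELength_eq_lintegral_mfderiv_Icc]
    calc _ ≤ ∫⁻ _ in Icc x y, ENNReal.ofReal C := by
          refine MeasureTheory.setLIntegral_mono measurable_const fun t ht => ?_
          obtain ⟨v, hv, hd⟩ := h.exists_hasMFDerivAt (hsub ht)
          have e : mfderiv 𝓘(ℝ, ℝ) I γ t (1 : ℝ) = v := by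
            rw [hd.mfderiv]
            exact one_smul ℝ v
          refine le_of_eq_of_le (congrArg (fun w : TangentSpace I (γ t) => ‖w‖ₑ) e) ?_
          rw [← ofReal_norm]
          exact ENNReal.ofReal_le_ofReal (hC _ v (S.velocities_subset_values _ hv))
      _ = ENNReal.ofReal (C * (y - x)) := by
          rw [MeasureTheory.setLIntegral_const, Real.volume_Icc, ENNReal.ofReal_mul hC0]
  rw [edist_dist] at h1
  exact (ENNReal.ofReal_le_ofReal_iff (mul_nonneg hC0 (sub_nonneg.2 hxy))).1 h1

/-- Trajectories of a bounded field are Lipschitz. -/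
lemma IsTrajectoryOn.dist_le (hr : 1 ≤ r) (hC0 : 0 ≤ C) (hC : ∀ p, ∀ v ∈ S.values p, ‖v‖ ≤ C)
    (hfin : S.tangency.Finite) (h : S.IsTrajectoryOn γ J) {a b : ℝ} (hab : a ≤ b)
    (hJ : Icc a b ⊆ J) : dist (γ a) (γ b) ≤ C * (b - a) := by
  have hγ := h.continuousOn.mono hJ
  have := image_le_of_forall_right_of_finite (f := fun s => dist (γ a) (γ s))
    (T := γ ⁻¹' S.tangency) hab hC0 (fun s hs => tendsto_const_nhds.dist (hγ s hs))
    ((hfin.image (dist (γ a))).subset (by rintro _ ⟨s, hs, rfl⟩; exact ⟨γ s, hs, rfl⟩))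
    fun s hs hsT => by
      have hs' : s ∈ Icc a b := ⟨hs.1, hs.2.le⟩
      obtain ⟨s', hs's, hsub, hp⟩ := h.piece_right s (hJ hs') hsT
        (not_isGreatest_of_lt hs.2 (hJ ⟨hab, le_rfl⟩))
      refine ⟨s', hs's, fun x hx => ?_⟩
      have hne : (𝓝[Ioo s x] s).NeBot := left_nhdsWithin_Ioo_neBot hx.1
      have hcs : ContinuousWithinAt γ (Ioo s x) s :=
        (h.continuousOn s (hJ hs')).mono
          ((Ioo_subset_Icc_self.trans (Icc_subset_Icc_right hx.2.le)).trans hsub)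
      have hlim : Tendsto (fun y => dist (γ y) (γ x) - C * (x - y)) (𝓝[Ioo s x] s)
          (𝓝 (dist (γ s) (γ x) - C * (x - s))) :=
        (hcs.dist continuousWithinAt_const).sub
          (by fun_prop : Continuous fun y : ℝ => C * (x - y)).continuousWithinAt
      have h2 := le_of_tendsto (b := 0) hlim (by
        filter_upwards [self_mem_nhdsWithin] with y hy
        have := hp.dist_le hr hC0 hC hy.1 hy.2.le hx.2
        linarith)
      have h3 := dist_triangle (γ a) (γ s) (γ x)
      linarith
  simpa using this

/-- Orbits of a bounded field are Lipschitz. -/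
lemma IsOrbit.dist_le (hr : 1 ≤ r) (hC0 : 0 ≤ C) (hC : ∀ p, ∀ v ∈ S.values p, ‖v‖ ≤ C)
    (hfin : S.tangency.Finite) (h : S.IsOrbit γ) (a b : ℝ) : dist (γ a) (γ b) ≤ C * |a - b| := by
  obtain ⟨J, hne, hcl, hconn, htraj, hmax, hmin⟩ := h
  have hproj : ∀ t, ∃ s ∈ J, γ t = γ s ∧
      (t = s ∨ (t < s ∧ IsLeast J s) ∨ (s < t ∧ IsGreatest J s)) := by
    intro t
    by_cases ht : t ∈ J
    · exact ⟨t, ht, rfl, Or.inl rfl⟩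
    obtain ⟨j, hj⟩ := hne
    rcases lt_or_gt_of_ne (fun h => ht (h ▸ hj) : t ≠ j) with htj | hjt
    · have hbel : ∀ x ∈ J, t < x := fun x hx => by
        by_contra! hxt
        exact ht (hconn.out hx hj ⟨hxt, htj.le⟩)
      have hl : IsLeast J (sInf J) := hcl.isLeast_csInf ⟨j, hj⟩ ⟨t, fun x hx => (hbel x hx).le⟩
      exact ⟨_, hl.1, (hmin _ hl).2 t (hbel _ hl.1).le, Or.inr (Or.inl ⟨hbel _ hl.1, hl⟩)⟩
    · have hab : ∀ x ∈ J, x < t := fun x hx => by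
        by_contra! hxt
        exact ht (hconn.out hj hx ⟨hjt.le, hxt⟩)
      have hl : IsGreatest J (sSup J) :=
        hcl.isGreatest_csSup ⟨j, hj⟩ ⟨t, fun x hx => (hab x hx).le⟩
      exact ⟨_, hl.1, (hmax _ hl).2 t (hab _ hl.1).le, Or.inr (Or.inr ⟨hab _ hl.1, hl⟩)⟩
  have main : ∀ a b, a ≤ b → dist (γ a) (γ b) ≤ C * (b - a) := by
    intro a b hab
    have h0 : γ a = γ b → dist (γ a) (γ b) ≤ C * (b - a) := fun he => by
      rw [he, dist_self]
      exact mul_nonneg hC0 (sub_nonneg.2 hab)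
    obtain ⟨a', ha', hea, hca⟩ := hproj a
    obtain ⟨b', hb', heb, hcb⟩ := hproj b
    by_cases hA : a' < a ∧ IsGreatest J a'
    · exact h0 (hea.trans ((hmax a' hA.2).2 b (hA.1.le.trans hab)).symm)
    by_cases hB : b < b' ∧ IsLeast J b'
    · exact h0 (((hmin b' hB.2).2 a (hab.trans hB.1.le)).trans heb.symm)
    replace hca : a = a' ∨ (a < a' ∧ IsLeast J a') := by tauto
    replace hcb : b = b' ∨ (b' < b ∧ IsGreatest J b') := by tauto
    have haa : a ≤ a' := hca.elim le_of_eq fun h => h.1.le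
    have hbb : b' ≤ b := hcb.elim (fun h => h.ge) fun h => h.1.le
    have hle : a' ≤ b' := by
      rcases hca with rfl | h1
      · rcases hcb with rfl | h2
        · exact hab
        · exact h2.2.2 ha'
      · exact h1.2.2 hb'
    rw [hea, heb]
    exact (htraj.dist_le hr hC0 hC hfin hle (hconn.out ha' hb')).trans
      (mul_le_mul_of_nonneg_left (by linarith) hC0)
  rcases le_total a b with hab | hab
  · rw [abs_sub_comm, abs_of_nonneg (sub_nonneg.2 hab)]
    exact main a b hab
  · rw [dist_comm, abs_of_nonneg (sub_nonneg.2 hab)]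
    exact main b a hab

end FilippovSystem

namespace FilippovSystem

section Rest

variable {E : Type*} [NormedAddCommGroup E] [NormedSpace ℝ E]
  {H : Type*} [TopologicalSpace H] {I : ModelWithCorners ℝ E H}
  {M : Type*} [TopologicalSpace M] [T1Space M] [ChartedSpace H M] [IsManifold I ∞ M] {r : ℕ∞}
  {S : FilippovSystem I M r} {γ : ℝ → M} {J : Set ℝ}

/-- The mean value inequality near a tangency point at which trajectories may not rest. -/
lemma IsTrajectoryOn.mul_sub_le_of_zero_notMem (h : S.IsTrajectoryOn γ J) {p : M}
    (hp : p ∈ S.tangency) (h0 : (0 : TangentSpace I p) ∉ S.values p) {N : Set M} (hN : IsOpen N)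
    (hNp : ∀ q ∈ N, q ∈ S.tangency → q = p) {G : M → ℝ}
    (hG : ∀ q ∈ N, MDifferentiableAt I 𝓘(ℝ, ℝ) G q) {c : ℝ} (hc0 : 0 < c)
    (hc : ∀ q ∈ N, ∀ v ∈ S.velocities q, c ≤ derivAlong G q v) {a b : ℝ} (hab : a ≤ b)
    (hJ : Icc a b ⊆ J) (hmaps : MapsTo γ (Icc a b) N) :
    c * (b - a) ≤ G (γ b) - G (γ a) := by
  have hγ : ContinuousOn γ (Icc a b) := h.continuousOn.mono hJ
  have hGγ : ContinuousOn (fun s => G (γ s)) (Icc a b) := fun s hs =>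
    (hG _ (hmaps hs)).continuousAt.comp_continuousWithinAt (hγ s hs)
  have step : ∀ x y, a ≤ x → x ≤ y → y ≤ b → (∀ z ∈ Ioo x y, γ z ≠ p) →
      c * (y - x) ≤ G (γ y) - G (γ x) := fun x y hx hxy hy hne =>
    h.satisfiesMeanValue.le_of_Ioo hxy
      ((Ioo_subset_Icc_self.trans (Icc_subset_Icc hx hy)).trans hJ)
      (hN.sdiff isClosed_singleton : IsOpen (N \ {p}))
      (fun z hz => ⟨hmaps (Icc_subset_Icc hx hy (Ioo_subset_Icc_self hz)), hne z hz⟩)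
      (disjoint_left.2 fun q hq hqt => hq.2 (hNp q hq.1 hqt)) (fun q hq => hG q hq.1)
      (hGγ.mono (Icc_subset_Icc hx hy)) (fun q hq => hc q hq.1)
  have hclosed : ∀ x y, a ≤ x → y ≤ b → IsCompact (Icc x y ∩ γ ⁻¹' {p}) := fun x y hx hy =>
    isCompact_Icc.of_isClosed_subset ((hγ.mono (Icc_subset_Icc hx hy)).preimage_isClosed_of_isClosed
      isClosed_Icc isClosed_singleton) inter_subset_left
  have huniq : ∀ s₁ ∈ Icc a b, ∀ s₂ ∈ Icc a b, γ s₁ = p → γ s₂ = p → ¬ s₁ < s₂ := by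
    intro s₁ hs₁ s₂ hs₂ h₁ h₂ hlt
    obtain ⟨s, hs, hsp⟩ : ∃ s ∈ Icc s₁ s₂, γ s ≠ p := by
      by_contra! hcon
      exact h0 (h.rest p hp s₁ s₂ hlt ((Icc_subset_Icc hs₁.1 hs₂.2).trans hJ) hcon)
    obtain ⟨x, ⟨hx, hxp⟩, hxmax⟩ := (hclosed s₁ s hs₁.1 (hs.2.trans hs₂.2)).exists_isGreatest
      ⟨s₁, ⟨le_rfl, hs.1⟩, h₁⟩
    obtain ⟨y, ⟨hy, hyp⟩, hymin⟩ := (hclosed s s₂ (hs₁.1.trans hs.1) hs₂.2).exists_isLeast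
      ⟨s₂, ⟨hs.2, le_rfl⟩, h₂⟩
    have hxs : x < s := lt_of_le_of_ne hx.2 (by rintro rfl; exact hsp hxp)
    have hsy : s < y := lt_of_le_of_ne hy.1 (by rintro rfl; exact hsp hyp)
    have := step x y (hs₁.1.trans hx.1) (hxs.trans hsy).le (hy.2.trans hs₂.2) fun z hz hzp => by
      rcases le_total z s with hzs | hzs
      · exact absurd (hxmax ⟨⟨hx.1.trans hz.1.le, hzs⟩, hzp⟩) (not_le.2 hz.1)
      · exact absurd (hymin ⟨⟨hzs, hz.2.le.trans hy.2⟩, hzp⟩) (not_le.2 hz.2)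
    rw [show γ x = p from hxp, show γ y = p from hyp, sub_self] at this
    exact absurd (mul_pos hc0 (sub_pos.2 (hxs.trans hsy))) (not_lt.2 this)
  by_cases hex : ∃ s ∈ Icc a b, γ s = p
  · obtain ⟨s, hs, hsp⟩ := hex
    have h1 := step a s le_rfl hs.1 hs.2 fun z hz hzp =>
      huniq z ⟨hz.1.le, hz.2.le.trans hs.2⟩ s hs hzp hsp hz.2
    have h2 := step s b hs.1 hs.2 le_rfl fun z hz hzp =>
      huniq s hs z ⟨hs.1.trans hz.1.le, hz.2.le⟩ hsp hzp hz.1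
    linarith
  · push Not at hex
    exact step a b le_rfl hab le_rfl fun z hz => hex z (Ioo_subset_Icc_self hz)

/-- If `0 ∉ Z(p)`, then some linear functional increases along all velocities near `p`. -/
lemma exists_increasing_functional (hr : 1 ≤ r) (hfin : S.tangency.Finite) {p : M}
    (hp : S.h p = 0) (h0 : (0 : TangentSpace I p) ∉ S.values p) :
    ∃ (G : M → ℝ) (N : Set M) (c : ℝ), IsOpen N ∧ p ∈ N ∧ 0 < c ∧
      (∀ q ∈ N, q ∈ S.tangency → q = p) ∧ (∀ q ∈ N, MDifferentiableAt I 𝓘(ℝ, ℝ) G q) ∧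
      ∀ q ∈ N, ∀ v ∈ S.velocities q, c ≤ derivAlong G q v := by
  have : IsManifold I 1 M := IsManifold.of_le (n := ∞) (by simp)
  set φ := extChartAt I p
  set u : E := derivAlong φ p (S.Zp p) with hu
  set w : E := derivAlong φ p (S.Zm p) with hw
  have hseg : (0 : E) ∉ segment ℝ u w := by
    rintro ⟨s, t, hs, ht, hst, he⟩
    rw [hu, hw, ← derivAlong_add_smul, derivAlong_extChartAt_self] at he
    refine h0 ⟨s - t, ⟨fun h' => absurd hp h'.ne', fun h' => absurd hp h'.ne,
      fun _ => ⟨by linarith, by linarith⟩⟩, ?_⟩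
    obtain rfl : t = 1 - s := by linarith
    refine Eq.trans (Eq.symm he) ?_
    module
  have hcomp : IsCompact (segment ℝ u w) := by
    rw [← Path.range_segment]
    exact isCompact_range (Path.segment u w).continuous
  obtain ⟨ℓ, c, hc0, hc⟩ := geometric_hahn_banach_point_closed (convex_segment u w)
    hcomp.isClosed hseg
  rw [map_zero] at hc0
  have hcu := hc u (left_mem_segment ℝ u w)
  have hcw := hc w (right_mem_segment ℝ u w)
  have hd : ∀ q ∈ (chartAt H p).source, MDifferentiableAt I 𝓘(ℝ, ℝ) (fun q => ℓ (φ q)) q ∧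
      ∀ v : TangentSpace I q, derivAlong (fun q => ℓ (φ q)) q v = ℓ (derivAlong φ q v) := by
    intro q hq
    have := derivAlong_comp_sub (mdifferentiableAt_extChartAt hq) (S.mdifferentiableAt_h hr q) ℓ 0
    simpa only [smul_zero, sub_zero] using this
  have hev : ∀ᶠ q in 𝓝 p, q ∈ (S.tangency \ {p})ᶜ ∧ q ∈ (chartAt H p).source ∧
      c < ℓ (derivAlong φ q (S.Zp q)) ∧ c < ℓ (derivAlong φ q (S.Zm q)) :=
    ((hfin.subset sdiff_subset).isClosed.isOpen_compl.eventually_mem (fun h => h.2 (mem_singleton p))).and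
      (((chartAt H p).open_source.eventually_mem (mem_chart_source H p)).and
      (((ℓ.continuous.continuousAt.comp (continuousAt_derivAlong_extChartAt p
        S.contMDiff_Zp.continuous)).eventually (lt_mem_nhds hcu)).and
      ((ℓ.continuous.continuousAt.comp (continuousAt_derivAlong_extChartAt p
        S.contMDiff_Zm.continuous)).eventually (lt_mem_nhds hcw))))
  obtain ⟨N, hN, hNo, hpN⟩ := eventually_nhds_iff.1 hev
  refine ⟨fun q => ℓ (φ q), N, c, hNo, hpN, hc0, fun q hq hqt => ?_,
    fun q hq => (hd q (hN q hq).2.1).1, fun q hq v hv => ?_⟩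
  · by_contra hne
    exact (hN q hq).1 ⟨hqt, hne⟩
  · refine S.derivAlong_mem_of_convex (convex_Ici c) ?_ ?_ hv
    · rw [(hd q (hN q hq).2.1).2]
      exact (hN q hq).2.2.1.le
    · rw [(hd q (hN q hq).2.1).2]
      exact (hN q hq).2.2.2.le

end Rest

section Boundary

variable {E : Type*} [NormedAddCommGroup E] [NormedSpace ℝ E]
  {H : Type*} [TopologicalSpace H] {I : ModelWithCorners ℝ E H}
  {M : Type*} [TopologicalSpace M] [ChartedSpace H M]

/-- Before its domain, an orbit is constant and on the boundary. -/
lemma stops_before {J : Set ℝ} (hcl : IsClosed J) (hne : J.Nonempty) {η : ℝ → M}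
    (hmin : ∀ t, IsLeast J t → η t ∈ I.boundary M ∧ ∀ s, s ≤ t → η s = η t) {t : ℝ}
    (ht : ∀ x ∈ J, t < x) : η t ∈ I.boundary M ∧ ∀ s ≤ t, η s = η t := by
  have hl : IsLeast J (sInf J) := hcl.isLeast_csInf hne ⟨t, fun x hx => (ht x hx).le⟩
  have h1 := (hmin _ hl).2
  have h2 := (ht _ hl.1).le
  exact ⟨(h1 t h2) ▸ (hmin _ hl).1, fun s hs => (h1 s (hs.trans h2)).trans (h1 t h2).symm⟩

/-- After its domain, an orbit is constant and on the boundary. -/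
lemma stops_after {J : Set ℝ} (hcl : IsClosed J) (hne : J.Nonempty) {η : ℝ → M}
    (hmax : ∀ t, IsGreatest J t → η t ∈ I.boundary M ∧ ∀ s, t ≤ s → η s = η t) {t : ℝ}
    (ht : ∀ x ∈ J, x < t) : η t ∈ I.boundary M ∧ ∀ s ≥ t, η s = η t := by
  have hl : IsGreatest J (sSup J) := hcl.isGreatest_csSup hne ⟨t, fun x hx => (ht x hx).le⟩
  have h1 := (hmax _ hl).2
  have h2 := (ht _ hl.1).le
  exact ⟨(h1 t h2) ▸ (hmax _ hl).1, fun s hs => (h1 s (h2.trans hs)).trans (h1 t h2).symm⟩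

end Boundary

section Limits

variable {E : Type*} [NormedAddCommGroup E] [NormedSpace ℝ E]
  {H : Type*} [TopologicalSpace H] {I : ModelWithCorners ℝ E H}
  {M : Type*} [MetricSpace M] [ChartedSpace H M] [IsManifold I ∞ M] {r : ℕ∞}
  {S : FilippovSystem I M r} {ι : Type*} {l : Filter ι} {u : ι → ℝ → M} {γ : ℝ → M} {C : ℝ}

lemma dist_le_of_tendsto [l.NeBot] (hC : ∀ k a b, dist (u k a) (u k b) ≤ C * |a - b|)
    (hlim : ∀ t, Tendsto (fun k => u k t) l (𝓝 (γ t))) (a b : ℝ) :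
    dist (γ a) (γ b) ≤ C * |a - b| :=
  le_of_tendsto ((hlim a).dist (hlim b)) (Eventually.of_forall fun k => hC k a b)

lemma continuous_of_dist_le (h : ∀ a b, dist (γ a) (γ b) ≤ C * |a - b|) : Continuous γ :=
  (LipschitzWith.of_dist_le' (K := C) fun a b => by rw [Real.dist_eq]; exact h a b).continuous

lemma eventually_mapsTo_Icc (hC : ∀ k a b, dist (u k a) (u k b) ≤ C * |a - b|)
    (hlim : ∀ t, Tendsto (fun k => u k t) l (𝓝 (γ t))) {N : Set M} (hN : IsOpen N) {a b : ℝ}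
    (hmaps : MapsTo γ (Icc a b) N) : ∀ᶠ k in l, MapsTo (u k) (Icc a b) N := by
  refine isCompact_Icc.induction_on (p := fun s => ∀ᶠ k in l, MapsTo (u k) s N)
    (Eventually.of_forall fun k => mapsTo_empty _ _)
    (fun s t hst h => h.mono fun k hk => hk.mono_left hst)
    (fun s t hs ht => (hs.and ht).mono fun k hk => hk.1.union hk.2) fun s hs => ?_
  obtain ⟨ε, hε, hball⟩ := Metric.isOpen_iff.1 hN _ (hmaps hs)
  have hcont : Continuous fun x : ℝ => C * |x - s| := by fun_prop
  have hsmall : ∀ᶠ x in 𝓝 s, C * |x - s| < ε / 2 :=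
    hcont.continuousAt.eventually (gt_mem_nhds (by simpa using half_pos hε))
  refine ⟨_, mem_nhdsWithin_of_mem_nhds hsmall, ?_⟩
  filter_upwards [Metric.tendsto_nhds.1 (hlim s) (ε / 2) (half_pos hε)] with k hk x hx
  refine hball ?_
  have h1 := hC k x s
  have h2 : C * |x - s| < ε / 2 := hx
  have h3 := dist_triangle (u k x) (u k s) (γ s)
  rw [Metric.mem_ball]
  linarith

/-- The mean value inequality passes to pointwise limits of equi-Lipschitz curves. -/
lemma SatisfiesMeanValue.of_tendsto [l.NeBot]
    (hC : ∀ k a b, dist (u k a) (u k b) ≤ C * |a - b|)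
    (hlim : ∀ t, Tendsto (fun k => u k t) l (𝓝 (γ t))) {J : ι → Set ℝ} {J₀ : Set ℝ}
    (hJ : ∀ k, (J k).OrdConnected) (hJ₀ : ∀ t ∈ J₀, ∀ᶠ k in l, t ∈ J k)
    (h : ∀ k, S.SatisfiesMeanValue (u k) (J k)) : S.SatisfiesMeanValue γ J₀ := by
  intro a b hab hsub N hN hmaps hdisj G hG c hc
  have ha : a ∈ Icc a b := ⟨le_rfl, hab⟩
  have hb : b ∈ Icc a b := ⟨hab, le_rfl⟩
  refine ge_of_tendsto (((hG _ (hmaps hb)).continuousAt.tendsto.comp (hlim b)).sub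
    ((hG _ (hmaps ha)).continuousAt.tendsto.comp (hlim a))) ?_
  filter_upwards [eventually_mapsTo_Icc hC hlim hN hmaps, hJ₀ a (hsub ha), hJ₀ b (hsub hb)]
    with k hk hka hkb
  exact h k a b hab ((hJ k).out hka hkb) N hN hk hdisj G hG c hc

lemma Ioo_subset_of_mem_closure {J₀ : Set ℝ} (hJ₀ : J₀.OrdConnected) {a b : ℝ}
    (ha : a ∈ closure J₀) (hb : b ∈ closure J₀) : Ioo a b ⊆ J₀ := by
  intro x hx
  obtain ⟨y, hy, hyJ⟩ := mem_closure_iff.1 ha (Iio x) isOpen_Iio hx.1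
  obtain ⟨z, hz, hzJ⟩ := mem_closure_iff.1 hb (Ioi x) isOpen_Ioi hx.2
  exact hJ₀.out hyJ hzJ ⟨(mem_Iio.1 hy).le, (mem_Ioi.1 hz).le⟩

lemma ordConnected_closure {J₀ : Set ℝ} (hJ₀ : J₀.OrdConnected) : (closure J₀).OrdConnected :=
  (convex_iff_ordConnected.1 (convex_iff_ordConnected.2 hJ₀).closure)

/-- Pointwise limits of equi-Lipschitz trajectories are trajectories. -/
lemma IsTrajectoryOn.of_tendsto [l.NeBot] (hr : 1 ≤ r) (hfin : S.tangency.Finite)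
    (hC : ∀ k a b, dist (u k a) (u k b) ≤ C * |a - b|)
    (hlim : ∀ t, Tendsto (fun k => u k t) l (𝓝 (γ t))) {J : ι → Set ℝ} {J₀ : Set ℝ}
    (hJ : ∀ k, (J k).OrdConnected) (hJ₀ : ∀ t ∈ J₀, ∀ᶠ k in l, t ∈ J k)
    (hconn : J₀.OrdConnected) (h : ∀ k, S.IsTrajectoryOn (u k) (J k)) :
    S.IsTrajectoryOn γ (closure J₀) := by
  have hγ : Continuous γ := continuous_of_dist_le (dist_le_of_tendsto hC hlim)
  have hmv : S.SatisfiesMeanValue γ (closure J₀) := by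
    intro a b hab hsub N hN hmaps hdisj G hG c hc
    refine (SatisfiesMeanValue.of_tendsto hC hlim hJ hJ₀
      fun k => (h k).satisfiesMeanValue).le_of_Ioo hab
      (Ioo_subset_of_mem_closure hconn (hsub ⟨le_rfl, hab⟩) (hsub ⟨hab, le_rfl⟩)) hN
      (hmaps.mono_left Ioo_subset_Icc_self) hdisj hG (fun s hs => ?_) hc
    exact (hG _ (hmaps hs)).continuousAt.comp_continuousWithinAt hγ.continuousWithinAt
  have hcl := ordConnected_closure hconn
  refine ⟨hγ.continuousOn, fun t ht htan hgr => ?_, fun t ht htan hle => ?_,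
    fun p hp a b hab hsub hrest => ?_⟩
  · obtain ⟨s, hs, hts⟩ : ∃ s ∈ closure J₀, t < s := by
      by_contra! hcon
      exact hgr ⟨ht, hcon⟩
    exact hmv.exists_piece_right hr hfin.isClosed hγ.continuousOn hts (hcl.out ht hs) htan
  · obtain ⟨s, hs, hst⟩ : ∃ s ∈ closure J₀, s < t := by
      by_contra! hcon
      exact hle ⟨ht, hcon⟩
    exact hmv.exists_piece_left hr hfin.isClosed hγ.continuousOn hst (hcl.out hs ht) htan
  · by_contra h0
    obtain ⟨G, N, c, hN, hpN, hc0, hNp, hG, hc⟩ := exists_increasing_functional hr hfin hp.1 h0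
    obtain ⟨x, hax, hxb⟩ := exists_between hab
    obtain ⟨y, hxy, hyb⟩ := exists_between hxb
    have hIoo := Ioo_subset_of_mem_closure hconn (hsub ⟨le_rfl, hab.le⟩) (hsub ⟨hab.le, le_rfl⟩)
    have hγp : ∀ t ∈ Icc x y, γ t = p := fun t ht =>
      hrest t ⟨hax.le.trans ht.1, ht.2.trans hyb.le⟩
    have hmaps : MapsTo γ (Icc x y) N := fun t ht => by rw [hγp t ht]; exact hpN
    have hx : x ∈ Icc x y := ⟨le_rfl, hxy.le⟩
    have hy : y ∈ Icc x y := ⟨hxy.le, le_rfl⟩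
    have hle : c * (y - x) ≤ G (γ y) - G (γ x) := by
      refine ge_of_tendsto (((hG _ (hmaps hy)).continuousAt.tendsto.comp (hlim y)).sub
        ((hG _ (hmaps hx)).continuousAt.tendsto.comp (hlim x))) ?_
      filter_upwards [eventually_mapsTo_Icc hC hlim hN hmaps, hJ₀ x (hIoo ⟨hax, hxb⟩),
        hJ₀ y (hIoo ⟨hax.trans hxy, hyb⟩)] with k hk hkx hky
      exact (h k).mul_sub_le_of_zero_notMem hp h0 hN hNp hG hc0 hc hxy.le ((hJ k).out hkx hky) hk
    rw [hγp x hx, hγp y hy, sub_self] at hle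
    exact absurd (mul_pos hc0 (sub_pos.2 hxy)) (not_lt.2 hle)

/-- A constant curve on the boundary is an orbit. -/
lemma isOrbit_const (hγ : ∀ t, γ t = γ 0) (h0 : γ 0 ∈ I.boundary M) : S.IsOrbit γ := by
  refine ⟨{0}, singleton_nonempty 0, isClosed_singleton, ordConnected_singleton,
    ⟨continuousOn_singleton _ _, ?_, ?_, ?_⟩, fun t _ => ?_, fun t _ => ?_⟩
  · rintro t rfl - hg
    exact absurd isGreatest_singleton hg
  · rintro t rfl - hg
    exact absurd isLeast_singleton hg
  · intro p _ a b hab hsub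
    have h1 : a = 0 := hsub ⟨le_rfl, hab.le⟩
    have h2 : b = 0 := hsub ⟨hab.le, le_rfl⟩
    linarith
  · exact ⟨(hγ t).symm ▸ h0, fun s _ => (hγ s).trans (hγ t).symm⟩
  · exact ⟨(hγ t).symm ▸ h0, fun s _ => (hγ s).trans (hγ t).symm⟩

/-- Pointwise limits of equi-Lipschitz orbits are orbits. -/
lemma IsOrbit.of_tendsto [FiniteDimensional ℝ E] (l : Ultrafilter ι) (hr : 1 ≤ r)
    (hfin : S.tangency.Finite) (hC : ∀ k a b, dist (u k a) (u k b) ≤ C * |a - b|)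
    (hlim : ∀ t, Tendsto (fun k => u k t) l (𝓝 (γ t))) (h : ∀ k, S.IsOrbit (u k)) :
    S.IsOrbit γ := by
  have : IsManifold I 1 M := IsManifold.of_le (n := ∞) (by simp)
  have hbd : IsClosed (I.boundary M) := I.isClosed_boundary (n := 1) one_ne_zero
  have hγ : Continuous γ := continuous_of_dist_le (dist_le_of_tendsto hC hlim)
  choose J hne hcl hJ htraj hmax hmin using h
  have hbefore : ∀ t, (∀ᶠ k in l, ∀ x ∈ J k, t < x) →
      γ t ∈ I.boundary M ∧ ∀ s ≤ t, γ s = γ t := fun t ht =>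
    ⟨hbd.mem_of_tendsto (hlim t) (ht.mono fun k hk => (stops_before (hcl k) (hne k) (hmin k) hk).1),
      fun s hs => tendsto_nhds_unique_of_eventuallyEq (hlim s) (hlim t)
        (ht.mono fun k hk => (stops_before (hcl k) (hne k) (hmin k) hk).2 s hs)⟩
  have hafter : ∀ t, (∀ᶠ k in l, ∀ x ∈ J k, x < t) →
      γ t ∈ I.boundary M ∧ ∀ s ≥ t, γ s = γ t := fun t ht =>
    ⟨hbd.mem_of_tendsto (hlim t) (ht.mono fun k hk => (stops_after (hcl k) (hne k) (hmax k) hk).1),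
      fun s hs => tendsto_nhds_unique_of_eventuallyEq (hlim s) (hlim t)
        (ht.mono fun k hk => (stops_after (hcl k) (hne k) (hmax k) hk).2 s hs)⟩
  have hout : ∀ k t, t ∉ J k → (∀ x ∈ J k, t < x) ∨ ∀ x ∈ J k, x < t := by
    intro k t ht
    by_contra! hcon
    obtain ⟨⟨x, hx, hxt⟩, y, hy, hty⟩ := hcon
    exact ht ((hJ k).out hx hy ⟨hxt, hty⟩)
  set J₀ : Set ℝ := {t | ∀ᶠ k in l, t ∈ J k} with hJ₀
  have hconn : J₀.OrdConnected := ⟨fun x hx y hy z hz =>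
    (hx.and hy).mono fun k hk => (hJ k).out hk.1 hk.2 hz⟩
  have houtJ₀ : ∀ t, t ∉ J₀ → (∀ᶠ k in l, ∀ x ∈ J k, t < x) ∨ ∀ᶠ k in l, ∀ x ∈ J k, x < t := by
    intro t ht
    have h1 : ∀ᶠ k in l, t ∉ J k := Ultrafilter.eventually_not.2 ht
    exact Ultrafilter.eventually_or.1 (h1.mono fun k hk => hout k t hk)
  rcases J₀.eq_empty_or_nonempty with hemp | ⟨j, hj⟩
  · have hcase : ∀ t, (∀ᶠ k in l, ∀ x ∈ J k, t < x) ∨ ∀ᶠ k in l, ∀ x ∈ J k, x < t :=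
      fun t => houtJ₀ t (by rw [hemp]; exact notMem_empty t)
    have hval : ∀ s t, s ≤ t → γ s = γ t ∨ ((∀ᶠ k in l, ∀ x ∈ J k, x < t) ∧
        ∀ᶠ k in l, ∀ x ∈ J k, s < x) := by
      intro s t hst
      rcases hcase t with ht | ht
      · exact Or.inl ((hbefore t ht).2 s hst)
      · rcases hcase s with hs | hs
        · exact Or.inr ⟨ht, hs⟩
        · exact Or.inl ((hafter s hs).2 t hst).symm
    have hconst : ∀ s t, s ≤ t → γ s = γ t := by
      intro s t hst
      rcases hval s t hst with he | ⟨ht, hs⟩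
      · exact he
      by_contra hne'
      have hsub : range γ ⊆ {γ s, γ t} := by
        rintro _ ⟨x, rfl⟩
        rcases hcase x with hx | hx
        · left
          rcases le_total s x with hsx | hxs
          · exact ((hbefore x hx).2 s hsx).symm
          · exact (hbefore s hs).2 x hxs
        · right
          rcases le_total t x with htx | hxt
          · exact (hafter t ht).2 x htx
          · exact ((hafter x hx).2 t hxt).symm
      exact (isPreconnected_range hγ).infinite_of_nontrivial
        ⟨γ s, mem_range_self s, γ t, mem_range_self t, hne'⟩
        ((toFinite {γ s, γ t}).subset hsub)
    refine isOrbit_const (fun t => ?_) ((hcase 0).elim (fun h => (hbefore 0 h).1)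
      fun h => (hafter 0 h).1)
    rcases le_total t 0 with h | h
    · exact hconst t 0 h
    · exact (hconst 0 t h).symm
  · refine ⟨closure J₀, ⟨j, subset_closure hj⟩, isClosed_closure, ordConnected_closure hconn,
      IsTrajectoryOn.of_tendsto hr hfin hC hlim hJ (fun t ht => ht) hconn htraj,
      fun t ht => ?_, fun t ht => ?_⟩
    · have hjt : j ≤ t := ht.2 (subset_closure hj)
      have hconst : ∀ s, t < s → γ s ∈ I.boundary M ∧ ∀ x ≥ s, γ x = γ s := fun s hs =>
        hafter s ((houtJ₀ s fun hsJ => absurd (ht.2 (subset_closure hsJ)) (not_le.2 hs)).resolve_left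
          fun hcon => by
            obtain ⟨k, hk1, hk2⟩ := (hcon.and hj).exists
            exact absurd (hk1 j hk2) (not_lt.2 (hjt.trans hs.le)))
      have heq : ∀ s, t < s → γ s = γ t := fun s hs => by
        refine tendsto_nhds_unique_of_eventuallyEq tendsto_const_nhds
          (hγ.continuousAt.tendsto.mono_left (nhdsWithin_le_nhds (s := Ioi t))) ?_
        filter_upwards [Ioc_mem_nhdsGT hs] with x hx
        exact (hconst x hx.1).2 s hx.2
      refine ⟨heq (t + 1) (lt_add_one t) ▸ (hconst _ (lt_add_one t)).1, fun s hs => ?_⟩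
      rcases hs.eq_or_lt with rfl | hlt
      · rfl
      · exact heq s hlt
    · have htj : t ≤ j := ht.2 (subset_closure hj)
      have hconst : ∀ s, s < t → γ s ∈ I.boundary M ∧ ∀ x ≤ s, γ x = γ s := fun s hs =>
        hbefore s ((houtJ₀ s fun hsJ => absurd (ht.2 (subset_closure hsJ)) (not_le.2 hs)).resolve_right
          fun hcon => by
            obtain ⟨k, hk1, hk2⟩ := (hcon.and hj).exists
            exact absurd (hk1 j hk2) (not_lt.2 (hs.le.trans htj)))
      have heq : ∀ s, s < t → γ s = γ t := fun s hs => by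
        refine tendsto_nhds_unique_of_eventuallyEq tendsto_const_nhds
          (hγ.continuousAt.tendsto.mono_left (nhdsWithin_le_nhds (s := Iio t))) ?_
        filter_upwards [Ico_mem_nhdsLT hs] with x hx
        exact (hconst x hx.2).2 s hx.1
      refine ⟨heq (t - 1) (sub_one_lt t) ▸ (hconst _ (sub_one_lt t)).1, fun s hs => ?_⟩
      rcases hs.eq_or_lt with rfl | hlt
      · rfl
      · exact heq s hlt

end Limits

end FilippovSystem

namespace FilippovSystem

variable {E : Type*} [NormedAddCommGroup E] [NormedSpace ℝ E]
  {H : Type*} [TopologicalSpace H] {I : ModelWithCorners ℝ E H}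
  {M : Type*} [MetricSpace M] [ChartedSpace H M] [IsManifold I ∞ M] {r : ℕ∞}
  {S : FilippovSystem I M r} {C : ℝ}

/-- A bound for the terms of the integral distance of two `C`-Lipschitz curves. -/
def distBound (A C : ℝ) (i : ℤ) : ℝ := 1 / 2 ^ i.natAbs * (A + 2 * C * (i.natAbs + 1))

lemma summable_distBound (A C : ℝ) : Summable (distBound A C) := by
  have h : Summable fun n : ℕ => (1 / 2 : ℝ) ^ n * (A + 2 * C * (n + 1)) := by
    have h1 : Summable fun n : ℕ => (1 / 2 : ℝ) ^ n := summable_geometric_two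
    have h2 : Summable fun n : ℕ => (n : ℝ) ^ 1 * (1 / 2 : ℝ) ^ n :=
      summable_pow_mul_geometric_of_norm_lt_one 1 (by norm_num)
    refine ((h1.mul_left (A + 2 * C)).add (h2.mul_left (2 * C))).congr fun n => ?_
    ring
  refine summable_int_iff_summable_nat_and_neg.2 ⟨?_, ?_⟩ <;>
  · refine h.congr fun n => ?_
    simp [distBound]

lemma continuous_dist_orbit (hlip : ∀ γ : S.OrbitSpace, ∀ a b, dist (γ.1 a) (γ.1 b) ≤ C * |a - b|)
    (γ₀ γ₁ : S.OrbitSpace) : Continuous fun t => dist (γ₀.1 t) (γ₁.1 t) :=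
  (continuous_of_dist_le (hlip γ₀)).dist (continuous_of_dist_le (hlip γ₁))

lemma dist_orbit_le (hC0 : 0 ≤ C)
    (hlip : ∀ γ : S.OrbitSpace, ∀ a b, dist (γ.1 a) (γ.1 b) ≤ C * |a - b|)
    (γ₀ γ₁ : S.OrbitSpace) {A : ℝ} (hA : dist (γ₀.1 0) (γ₁.1 0) ≤ A) {i : ℤ} {t : ℝ}
    (ht : t ∈ Icc (i : ℝ) (i + 1)) :
    dist (γ₀.1 t) (γ₁.1 t) ≤ A + 2 * C * (i.natAbs + 1) := by
  have h1 := dist_triangle4 (γ₀.1 t) (γ₀.1 0) (γ₁.1 0) (γ₁.1 t)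
  have h2 := hlip γ₀ t 0
  have h3 := hlip γ₁ 0 t
  rw [sub_zero] at h2
  rw [zero_sub, abs_neg] at h3
  have h4 : |t| ≤ i.natAbs + 1 := by
    rw [Nat.cast_natAbs, Int.cast_abs]
    have := abs_le.1 (le_refl |(i : ℝ)|)
    exact abs_le.2 ⟨by linarith [ht.1], by linarith [ht.2]⟩
  have h5 := mul_le_mul_of_nonneg_left h4 hC0
  linarith

lemma distTerm_nonneg (γ₀ γ₁ : S.OrbitSpace) (i : ℤ) : 0 ≤ S.distTerm γ₀ γ₁ i :=
  mul_nonneg (by positivity) (intervalIntegral.integral_nonneg (by linarith) fun _ _ => dist_nonneg)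

lemma distTerm_le (hC0 : 0 ≤ C)
    (hlip : ∀ γ : S.OrbitSpace, ∀ a b, dist (γ.1 a) (γ.1 b) ≤ C * |a - b|)
    (γ₀ γ₁ : S.OrbitSpace) {A : ℝ} (hA : dist (γ₀.1 0) (γ₁.1 0) ≤ A) (i : ℤ) :
    S.distTerm γ₀ γ₁ i ≤ distBound A C i := by
  refine mul_le_mul_of_nonneg_left ?_ (by positivity)
  have h := intervalIntegral.norm_integral_le_of_norm_le_const (a := (i : ℝ)) (b := i + 1)
    (f := fun t => dist (γ₀.1 t) (γ₁.1 t)) (C := A + 2 * C * (i.natAbs + 1)) fun t ht => by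
      rw [uIoc_of_le (by linarith)] at ht
      rw [Real.norm_of_nonneg dist_nonneg]
      exact dist_orbit_le hC0 hlip γ₀ γ₁ hA (Ioc_subset_Icc_self ht)
  have h2 := (le_abs_self _).trans h
  simpa using h2

lemma summable_distTerm (hC0 : 0 ≤ C)
    (hlip : ∀ γ : S.OrbitSpace, ∀ a b, dist (γ.1 a) (γ.1 b) ≤ C * |a - b|)
    (γ₀ γ₁ : S.OrbitSpace) : Summable (S.distTerm γ₀ γ₁) :=
  Summable.of_nonneg_of_le (distTerm_nonneg γ₀ γ₁) (distTerm_le hC0 hlip γ₀ γ₁ le_rfl)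
    (summable_distBound _ _)

lemma intDist_self (γ : S.OrbitSpace) : S.intDist γ γ = 0 := by
  simp [intDist, distTerm]

lemma intDist_comm (γ₀ γ₁ : S.OrbitSpace) : S.intDist γ₀ γ₁ = S.intDist γ₁ γ₀ := by
  simp only [intDist, distTerm, dist_comm]

lemma intDist_triangle (hC0 : 0 ≤ C)
    (hlip : ∀ γ : S.OrbitSpace, ∀ a b, dist (γ.1 a) (γ.1 b) ≤ C * |a - b|)
    (γ₀ γ₁ γ₂ : S.OrbitSpace) : S.intDist γ₀ γ₂ ≤ S.intDist γ₀ γ₁ + S.intDist γ₁ γ₂ := by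
  have hs := summable_distTerm hC0 hlip
  have hc := continuous_dist_orbit hlip
  rw [intDist, intDist, intDist, ← (hs γ₀ γ₁).tsum_add (hs γ₁ γ₂)]
  refine (hs γ₀ γ₂).tsum_le_tsum (fun i => ?_) ((hs γ₀ γ₁).add (hs γ₁ γ₂))
  rw [distTerm, distTerm, distTerm, ← mul_add, ← intervalIntegral.integral_add
    ((hc γ₀ γ₁).intervalIntegrable _ _) ((hc γ₁ γ₂).intervalIntegrable _ _)]
  refine mul_le_mul_of_nonneg_left ?_ (by positivity)
  exact intervalIntegral.integral_mono_on (by linarith) ((hc γ₀ γ₂).intervalIntegrable _ _)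
    (((hc γ₀ γ₁).add (hc γ₁ γ₂)).intervalIntegrable _ _) fun t _ => dist_triangle _ _ _

/-- Orbits that are far apart at some time have a large integral distance. -/
lemma le_mul_intDist (hC0 : 0 ≤ C)
    (hlip : ∀ γ : S.OrbitSpace, ∀ a b, dist (γ.1 a) (γ.1 b) ≤ C * |a - b|)
    (γ₀ γ₁ : S.OrbitSpace) (t : ℝ) {ε : ℝ} (hε : 0 < ε) (h : ε ≤ dist (γ₀.1 t) (γ₁.1 t)) :
    min 1 (ε / (2 * (2 * C + 1))) * (ε / 2) ≤
      (2 ^ ⌊t⌋.natAbs + 2 ^ (⌊t⌋ + 1).natAbs) * S.intDist γ₀ γ₁ := by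
  set i := ⌊t⌋
  set η := min 1 (ε / (2 * (2 * C + 1)))
  have hη : 0 < η := lt_min one_pos (by positivity)
  set f : ℝ → ℝ := fun t => dist (γ₀.1 t) (γ₁.1 t) with hf
  have hint : ∀ a b, IntervalIntegrable f MeasureTheory.volume a b :=
    fun a b => (continuous_dist_orbit hlip γ₀ γ₁).intervalIntegrable a b
  have hterm : ∀ j : ℤ, ∫ x in (j : ℝ)..(j + 1), f x ≤ 2 ^ j.natAbs * S.intDist γ₀ γ₁ := fun j => by
    have h1 : S.distTerm γ₀ γ₁ j ≤ S.intDist γ₀ γ₁ :=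
      (summable_distTerm hC0 hlip γ₀ γ₁).le_tsum j fun k _ => distTerm_nonneg γ₀ γ₁ k
    have h2 := mul_le_mul_of_nonneg_left h1 (by positivity : (0 : ℝ) ≤ 2 ^ j.natAbs)
    rw [distTerm, ← mul_assoc, mul_one_div_cancel (by positivity), one_mul] at h2
    exact h2
  have hlow : ∀ x ∈ Icc t (t + η), ε / 2 ≤ f x := fun x hx => by
    have h1 := dist_triangle4 (γ₀.1 t) (γ₀.1 x) (γ₁.1 x) (γ₁.1 t)
    have h2 := hlip γ₀ t x
    have h3 := hlip γ₁ x t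
    have hx' : |x - t| ≤ ε / (2 * (2 * C + 1)) := by
      rw [abs_of_nonneg (sub_nonneg.2 hx.1)]
      linarith [hx.2, min_le_right 1 (ε / (2 * (2 * C + 1)))]
    rw [abs_sub_comm] at h2
    have h4 : (2 * C + 1) * |x - t| ≤ ε / 2 := by
      rw [le_div_iff₀ (by positivity)] at hx'
      linarith
    have h5 := abs_nonneg (x - t)
    simp only [hf]
    linarith
  have hηint : η * (ε / 2) ≤ ∫ x in t..(t + η), f x := by
    have := intervalIntegral.integral_mono_on (by linarith) intervalIntegrable_const
      (hint t (t + η)) hlow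
    rwa [intervalIntegral.integral_const, add_sub_cancel_left, smul_eq_mul] at this
  have hit : (i : ℝ) ≤ t := Int.floor_le t
  have hti : t + η ≤ i + 1 + 1 := by
    linarith [Int.lt_floor_add_one t, min_le_left 1 (ε / (2 * (2 * C + 1)))]
  have hmono : ∫ x in t..(t + η), f x ≤ ∫ x in (i : ℝ)..(i + 1 + 1), f x :=
    intervalIntegral.integral_mono_interval hit (by linarith) hti
      (Eventually.of_forall fun _ => dist_nonneg) (hint _ _)
  have hadd := intervalIntegral.integral_add_adjacent_intervals
    (hint (i : ℝ) (i + 1)) (hint (i + 1) (i + 1 + 1))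
  have h1 := hterm i
  have h2 := hterm (i + 1)
  push_cast at h2
  rw [add_mul]
  linarith

lemma exists_intDist_lt_imp (hC0 : 0 ≤ C)
    (hlip : ∀ γ : S.OrbitSpace, ∀ a b, dist (γ.1 a) (γ.1 b) ≤ C * |a - b|) (t : ℝ) {ε : ℝ}
    (hε : 0 < ε) :
    ∃ δ > 0, ∀ γ₀ γ₁ : S.OrbitSpace, S.intDist γ₀ γ₁ < δ → dist (γ₀.1 t) (γ₁.1 t) < ε := by
  have hK : (0 : ℝ) < 2 ^ ⌊t⌋.natAbs + 2 ^ (⌊t⌋ + 1).natAbs := by positivity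
  refine ⟨min 1 (ε / (2 * (2 * C + 1))) * (ε / 2) / (2 ^ ⌊t⌋.natAbs + 2 ^ (⌊t⌋ + 1).natAbs),
    div_pos (mul_pos (lt_min one_pos (by positivity)) (half_pos hε)) hK, fun γ₀ γ₁ h => ?_⟩
  by_contra! hle
  have := le_mul_intDist hC0 hlip γ₀ γ₁ t hε hle
  rw [lt_div_iff₀ hK] at h
  linarith

/-- The integral distance as a metric. -/
abbrev orbitMetric (hC0 : 0 ≤ C)
    (hlip : ∀ γ : S.OrbitSpace, ∀ a b, dist (γ.1 a) (γ.1 b) ≤ C * |a - b|) :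
    MetricSpace S.OrbitSpace where
  dist := S.intDist
  dist_self := intDist_self
  dist_comm := intDist_comm
  dist_triangle := intDist_triangle hC0 hlip
  eq_of_dist_eq_zero := fun {γ₀ γ₁} h => by
    refine Subtype.ext (funext fun t => ?_)
    refine eq_of_forall_dist_le fun ε hε => ?_
    obtain ⟨δ, hδ, hlt⟩ := exists_intDist_lt_imp hC0 hlip t hε
    exact (hlt γ₀ γ₁ (lt_of_eq_of_lt h hδ)).le

/-- Pointwise convergence of orbits implies convergence in the integral distance. -/
lemma tendsto_intDist (hC0 : 0 ≤ C)
    (hlip : ∀ γ : S.OrbitSpace, ∀ a b, dist (γ.1 a) (γ.1 b) ≤ C * |a - b|)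
    {u : ℕ → S.OrbitSpace} {γ : S.OrbitSpace}
    (hlim : ∀ t, Tendsto (fun k => (u k).1 t) atTop (𝓝 (γ.1 t))) :
    Tendsto (fun k => S.intDist (u k) γ) atTop (𝓝 0) := by
  have hA : ∀ᶠ k in atTop, dist ((u k).1 0) (γ.1 0) ≤ 1 :=
    (Metric.tendsto_nhds.1 (hlim 0) 1 one_pos).mono fun k hk => hk.le
  have hterm : ∀ i, Tendsto (fun k => S.distTerm (u k) γ i) atTop (𝓝 0) := fun i => by
    have h1 : Tendsto (fun k => ∫ t in (i : ℝ)..(i + 1), dist ((u k).1 t) (γ.1 t)) atTop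
        (𝓝 (∫ t in (i : ℝ)..(i + 1), (0 : ℝ))) := by
      refine intervalIntegral.tendsto_integral_filter_of_dominated_convergence
        (fun _ => 1 + 2 * C * (i.natAbs + 1))
        (Eventually.of_forall fun k => (continuous_dist_orbit hlip (u k) γ).aestronglyMeasurable)
        (hA.mono fun k hk => Eventually.of_forall fun t ht => ?_) intervalIntegrable_const
        (Eventually.of_forall fun t _ => tendsto_iff_dist_tendsto_zero.1 (hlim t))
      rw [uIoc_of_le (by linarith)] at ht
      rw [Real.norm_of_nonneg dist_nonneg]
      exact dist_orbit_le hC0 hlip (u k) γ hk (Ioc_subset_Icc_self ht)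
    simpa [distTerm] using h1.const_mul (1 / 2 ^ i.natAbs : ℝ)
  have := tendsto_tsum_of_dominated_convergence (summable_distBound 1 C) hterm
    (hA.mono fun k hk i => by
      rw [Real.norm_of_nonneg (distTerm_nonneg _ _ _)]
      exact distTerm_le hC0 hlip (u k) γ hk i)
  rwa [tsum_zero] at this

/-- A Cauchy sequence of orbits converges pointwise to an orbit. -/
lemma exists_limit [FiniteDimensional ℝ E] [CompleteSpace M] (hr : 1 ≤ r)
    (hfin : S.tangency.Finite) (hC0 : 0 ≤ C)
    (hlip : ∀ γ : S.OrbitSpace, ∀ a b, dist (γ.1 a) (γ.1 b) ≤ C * |a - b|) (u : ℕ → S.OrbitSpace)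
    (hu : ∀ ε > 0, ∃ N, ∀ k ≥ N, ∀ l ≥ N, S.intDist (u k) (u l) < ε) :
    ∃ γ : S.OrbitSpace, (∀ t, Tendsto (fun k => (u k).1 t) atTop (𝓝 (γ.1 t))) ∧
      Tendsto (fun k => S.intDist (u k) γ) atTop (𝓝 0) ∧
      ((∀ k, S.IsTrajectoryOn (u k).1 univ) → S.IsTrajectoryOn γ.1 univ) := by
  have hcauchy : ∀ t, CauchySeq fun k => (u k).1 t := fun t => by
    refine Metric.cauchySeq_iff.2 fun ε hε => ?_
    obtain ⟨δ, hδ, hlt⟩ := exists_intDist_lt_imp hC0 hlip t hε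
    obtain ⟨N, hN⟩ := hu δ hδ
    exact ⟨N, fun k hk l hl => hlt _ _ (hN k hk l hl)⟩
  choose γ hγ using fun t => cauchySeq_tendsto_of_complete (hcauchy t)
  have horb : S.IsOrbit γ := IsOrbit.of_tendsto (Ultrafilter.of atTop) hr hfin
    (fun k => hlip (u k)) (fun t => (hγ t).mono_left (Ultrafilter.of_le _)) fun k => (u k).2
  refine ⟨⟨γ, horb⟩, hγ, tendsto_intDist hC0 hlip hγ, fun h => ?_⟩
  have := IsTrajectoryOn.of_tendsto (J := fun _ => univ) (J₀ := univ) hr hfin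
    (fun k => hlip (u k)) hγ (fun _ => ordConnected_univ)
    (fun t _ => Eventually.of_forall fun _ => mem_univ t) ordConnected_univ h
  rwa [closure_univ] at this

end FilippovSystem

end

theorem mainTheorem4
    {E : Type*} [NormedAddCommGroup E] [NormedSpace ℝ E] [FiniteDimensional ℝ E]
    {H : Type*} [TopologicalSpace H] {I : ModelWithCorners ℝ E H}
    {M : Type*} [MetricSpace M] [CompleteSpace M] [ChartedSpace H M] [IsManifold I ∞ M]
    [Bundle.RiemannianBundle (fun p : M => TangentSpace I p)]
    [IsContMDiffRiemannianBundle I ∞ E (fun p : M => TangentSpace I p)]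
    [IsRiemannianManifold I M]
    {r : ℕ∞} (hr : 1 ≤ r) (S : FilippovSystem I M r)
    (hbdd : S.Bounded) (hfin : S.tangency.Finite) :
    -- the series of integrals that defines the distance converges
    (∀ γ₀ γ₁ : S.OrbitSpace,
      (∀ i : ℤ, IntervalIntegrable (fun t => dist (γ₀.1 t) (γ₁.1 t))
        MeasureTheory.volume (i : ℝ) (i + 1)) ∧
      Summable (S.distTerm γ₀ γ₁)) ∧
    -- the integral distance is a complete metric on the orbit space
    (∃ m : MetricSpace S.OrbitSpace,
      (∀ γ₀ γ₁ : S.OrbitSpace, m.dist γ₀ γ₁ = S.intDist γ₀ γ₁) ∧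
      @CompleteSpace S.OrbitSpace m.toUniformSpace) ∧
    -- a Cauchy sequence of orbits converges pointwise, and its pointwise limit is an orbit
    (∀ u : ℕ → S.OrbitSpace,
      (∀ ε > 0, ∃ N, ∀ k ≥ N, ∀ l ≥ N, S.intDist (u k) (u l) < ε) →
      ∃ γ : S.OrbitSpace,
        (∀ t, Tendsto (fun k => (u k).1 t) atTop (𝓝 (γ.1 t))) ∧
        Tendsto (fun k => S.intDist (u k) γ) atTop (𝓝 0) ∧
        -- if all orbits of the sequence are trajectories for all time, then so is the limit
        ((∀ k, S.IsTrajectoryOn (u k).1 univ) → S.IsTrajectoryOn γ.1 univ)) := by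
  obtain ⟨C, hC0, hC⟩ := FilippovSystem.exists_nonneg_bound hbdd
  have hlip : ∀ γ : S.OrbitSpace, ∀ a b, dist (γ.1 a) (γ.1 b) ≤ C * |a - b| := fun γ =>
    FilippovSystem.IsOrbit.dist_le hr hC0 hC hfin γ.2
  refine ⟨fun γ₀ γ₁ => ⟨fun i =>
    (FilippovSystem.continuous_dist_orbit hlip γ₀ γ₁).intervalIntegrable _ _,
    FilippovSystem.summable_distTerm hC0 hlip γ₀ γ₁⟩,
    ⟨FilippovSystem.orbitMetric hC0 hlip, fun _ _ => rfl, ?_⟩,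
    FilippovSystem.exists_limit hr hfin hC0 hlip⟩
  let m : MetricSpace S.OrbitSpace := FilippovSystem.orbitMetric hC0 hlip
  refine Metric.complete_of_cauchySeq_tendsto fun u hu => ?_
  obtain ⟨γ, -, hγ, -⟩ := FilippovSystem.exists_limit hr hfin hC0 hlip u
    fun ε hε => Metric.cauchySeq_iff.1 hu ε hε
  exact ⟨γ, tendsto_iff_dist_tendsto_zero.2 hγ⟩
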